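/- **Theorem 2.2 (Well-posedness).** Let $N\in\mathbb N$, let $B_r$ be the open Euclidean ball of radius $r$ centred at $0$ in $\mathbb R^N$, $B_r(x)$ the one centred at $x$, and $B=B_1$. Let $\lambda>0$, and let $(\nu_\xi)_{\xi\in\mathbb R^N}$ be a family of Lévy measures on $\mathbb R^N$, i.e. positive Borel measures with $\nu_\xi(\{0\})=0$ and $\int\min(1,|z|^2)\,\nu_\xi(dz)<\infty$, such that: - (M1) there is $C_\nu>0$ with $\sup_\xi\int_{\mathbb R^N}\min(1,|z|^2)\,\nu_\xi(dz)\le C_\nu$; - (M2) $\sup_\xi\nu_\xi(\mathbb R^N\setminus B_R)\to0$ as $R\to\infty$; - (M3) for all $0<r<R$ there is a modulus of continuity $\omega_{R,r}$ with $|\nu_x-\nu_y|(B_R\setminus B_r)\le\omega_{R,r}(|x-y|)$ for all $x,y\in\mathbb R^N$; - (M4) there are $r_0\in(0,1)$ and a function $g\ge0$ with $g(r)\to0$ as $r\searrow0$ such that $W_2(\nu_x,\nu_y)(B_r)\le g(r)\,|x-y|^{1/2}$ for all $0<r<r_0$ and all $x,y\in\mathbb R^N$. Here a modulus of continuity is a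 function $\omega:[0,\infty)\to[0,\infty)$ with $\omega(0)=0$ and $\omega(s)\to0$ as $s\to0$; $|\nu_1-\nu_2|(A)=\sup_{E\subseteq A}(\nu_1(E)-\nu_2(E))+\sup_{E\subseteq A}(\nu_2(E)-\nu_1(E))$ (with $E$ measurable) is the total variation; and $$W_2(\nu_1,\nu_2)(B_r)=\Big(\inf_\gamma\int_{B_r\times B_r}|z_1-z_2|^2\,d\gamma(z_1,z_2)\Big)^{1/2},$$ where $\gamma$ ranges over the positive measures on $B_r\times B_r$ with $\gamma(\{(0,0)\})=0$ whose two marginals, restricted to $B_r\setminus\{0\}$, are the restrictions of $\nu_1$ and $\nu_2$ to $B_r$. Let $m>1$ and let $H:\mathbb R^N\times\mathbb R^N\to\mathbb R$ satisfy: - (H0) $H$ is continuous and $\sup_{x}|H(x,0)|<\infty$; - (H1) there are moduli of continuity $\omega^1_H,\omega^2_H$ such that for all $x,y,p,q\in\mathbb R^N$ with $|q|\le1$, $$H(y,p+q)-H(x,p)\le\omega^1_H(|x-y|)(1+|p|^m)+\omega^2_H(|q|)(1+|p|^{m-1});$$ - (H2) there are $b_m,b_0,r_0>0$ and $\mu_0\in(0,1)$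 such that for all $\mu\in[\mu_0,1]$ and all $x,p\in\mathbb R^N$ with $|p|\ge r_0$, $$\mu H(x,\mu^{-1}p)-H(x,p)\ge(1-\mu)(b_m|p|^m-b_0).$$ Then there exists a unique bounded continuous viscosity solution $u:\mathbb R^N\to\mathbb R$ of $$\lambda u-\mathcal I_xu(x)+H(x,Du)=0\quad\text{in }\mathbb R^N,$$ where $\mathcal I_\xi u(x)=\int_{\mathbb R^N}\big(u(x+z)-u(x)-\mathbf 1_B(z)\,Du(x)\cdot z\big)\,\nu_\xi(dz)$. Viscosity solutions are understood as follows. For measurable $A$ set $\mathcal I[A](x,p,\phi)=\int_A(\phi(x+z)-\phi(x)-\mathbf 1_B(z)\,p\cdot z)\,\nu_x(dz)$. A bounded upper (resp. lower) semicontinuous $u$ is a viscosity subsolution (resp. supersolution) if, for every $\bar x\in\mathbb R^N$, every $\delta>0$ and every bounded $\phi:\mathbb R^N\to\mathbb R$ of class $C^2$ on $B_\delta(\bar x)$ such that $u-\phi$ attains its maximum (resp. minimum) over $B_\delta(\bar x)$ at $\bar x$, $$\lambda u(\bar x)-\mathcal I[B_\delta](\bar x,D\phi(\bar x),\phi)-\mathcal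 I[\mathbb R^N\setminus B_\delta](\bar x,D\phi(\bar x),u)+H(\bar x,D\phi(\bar x))\le0\quad(\text{resp. }\ge0).$$ A viscosity solution is a bounded continuous function that is both a subsolution and a supersolution. -/

import Mathlib

open MeasureTheory Filter Topology Metric
open scoped NNReal ENNReal

namespace NonlocalHJ

/-- The Euclidean space `ℝ^N`. -/
abbrev Space (N : ℕ) : Type := EuclideanSpace ℝ (Fin N)

/-- A function on `ℝ^N` that is bounded everywhere. -/
def IsBddFun {N : ℕ} (f : Space N → ℝ) : Prop :=
  ∃ C : ℝ, ∀ x, |f x| ≤ C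

/-- A modulus of continuity: `ω(s) → 0` as `s → 0`; in particular `ω(0) = 0`. -/
def IsModulus (ω : ℝ≥0 → ℝ≥0) : Prop :=
  Tendsto ω (𝓝 0) (𝓝 0)

/-! ### Lévy measures and distances between them -/

/-- Lévy measures on `ℝ^N`: no mass at the origin and `∫ min(1,|z|²) dν < ∞`. -/
def IsLevyMeasure {N : ℕ} (ν : Measure (Space N)) : Prop :=
  ν {0} = 0 ∧ ∫⁻ z, ENNReal.ofReal (min 1 (‖z‖ ^ 2)) ∂ν < ∞

/-- `(ν₁ - ν₂)⁺(A) = sup {ν₁(E) - ν₂(E) : E ⊆ A measurable}`. The supremum is nonnegative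
(take `E = ∅`), so that truncated subtraction does not change it; `A` will be a set on which
both measures are finite. -/
noncomputable def posVariation {N : ℕ} (ν₁ ν₂ : Measure (Space N)) (A : Set (Space N)) : ℝ≥0∞ :=
  ⨆ (E : Set (Space N)) (_ : MeasurableSet E) (_ : E ⊆ A), (ν₁ E - ν₂ E)

/-- The total variation `|ν₁ - ν₂|(A) = (ν₁ - ν₂)⁺(A) + (ν₁ - ν₂)⁻(A)`. -/
noncomputable def totalVar {N : ℕ} (ν₁ ν₂ : Measure (Space N)) (A : Set (Space N)) : ℝ≥0∞ :=
  posVariation ν₁ ν₂ A + posVariation ν₂ ν₁ A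

/-- Admissible couplings of two measures `ν₁, ν₂` living on `A ∋ 0`: measures on `A × A` without
mass at `(0,0)` whose marginals, restricted to `A \ {0}`, are `ν₁` and `ν₂`. -/
def Admissible {N : ℕ} (A : Set (Space N)) (ν₁ ν₂ : Measure (Space N)) :
    Set (Measure (Space N × Space N)) :=
  {γ | γ (A ×ˢ A)ᶜ = 0 ∧ γ {((0 : Space N), (0 : Space N))} = 0 ∧
    (γ.map Prod.fst).restrict (A \ {0}) = ν₁ ∧
    (γ.map Prod.snd).restrict (A \ {0}) = ν₂}

/-- The quadratic Wasserstein distance between `ν₁` and `ν₂`, restricted to the ball `B_r`. -/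
noncomputable def wasserstein2 {N : ℕ} (ν₁ ν₂ : Measure (Space N)) (r : ℝ) : ℝ≥0∞ :=
  (⨅ γ ∈ Admissible (ball (0 : Space N) r)
      (ν₁.restrict (ball 0 r)) (ν₂.restrict (ball 0 r)),
    ∫⁻ z in ball (0 : Space N) r ×ˢ ball (0 : Space N) r,
      ENNReal.ofReal (‖z.1 - z.2‖ ^ 2) ∂γ) ^ (1 / 2 : ℝ)

/-! ### Assumptions on the family of Lévy measures -/

/-- Uniform Lévy condition. -/
def AssumptionM1 {N : ℕ} (ν : Space N → Measure (Space N)) : Prop :=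
  ∃ C : ℝ, 0 < C ∧ ∀ ξ, ∫⁻ z, ENNReal.ofReal (min 1 (‖z‖ ^ 2)) ∂(ν ξ) ≤ ENNReal.ofReal C

/-- Uniform decay at infinity. -/
def AssumptionM2 {N : ℕ} (ν : Space N → Measure (Space N)) : Prop :=
  Tendsto (fun R : ℝ => ⨆ ξ, ν ξ (ball (0 : Space N) R)ᶜ) atTop (𝓝 0)

/-- Continuity in total variation away from the origin. -/
def AssumptionM3 {N : ℕ} (ν : Space N → Measure (Space N)) : Prop :=
  ∀ r R : ℝ, 0 < r → r < R → ∃ ω : ℝ≥0 → ℝ≥0, IsModulus ω ∧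
    ∀ x y, totalVar (ν x) (ν y) (ball 0 R \ ball 0 r) ≤ (ω ‖x - y‖₊ : ℝ≥0∞)

/-- Local `1/2`-Hölder continuity in the Wasserstein distance, with a constant that vanishes with
the radius, uniformly in the two points. -/
def AssumptionM4 {N : ℕ} (ν : Space N → Measure (Space N)) : Prop :=
  ∃ r₀ : ℝ, 0 < r₀ ∧ r₀ < 1 ∧ ∃ g : ℝ → ℝ≥0, Tendsto g (𝓝[>] 0) (𝓝 0) ∧
    ∀ r : ℝ, 0 < r → r < r₀ → ∀ x y,
      wasserstein2 (ν x) (ν y) r ≤ ENNReal.ofReal (g r * ‖x - y‖ ^ (1 / 2 : ℝ))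

/-! ### Assumptions on the Hamiltonian -/

/-- Continuity, and boundedness of `H(·,0)`. -/
def AssumptionH0 {N : ℕ} (H : Space N → Space N → ℝ) : Prop :=
  Continuous (fun q : Space N × Space N => H q.1 q.2) ∧ IsBddFun (fun x => H x 0)

/-- Continuity of the data, with exponent `m`. -/
def AssumptionH1 {N : ℕ} (H : Space N → Space N → ℝ) (m : ℝ) : Prop :=
  ∃ ω₁ ω₂ : ℝ≥0 → ℝ≥0, IsModulus ω₁ ∧ IsModulus ω₂ ∧
    ∀ x y p q : Space N, ‖q‖ ≤ 1 →
      H y (p + q) - H x p ≤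
        ω₁ ‖x - y‖₊ * (1 + ‖p‖ ^ m) + ω₂ ‖q‖₊ * (1 + ‖p‖ ^ (m - 1))

/-- Superlinear coercivity, with exponent `m`. -/
def AssumptionH2 {N : ℕ} (H : Space N → Space N → ℝ) (m : ℝ) : Prop :=
  ∃ bₘ b₀ r₀ μ₀ : ℝ, 0 < bₘ ∧ 0 < b₀ ∧ 0 < r₀ ∧ 0 < μ₀ ∧ μ₀ < 1 ∧
    ∀ μ : ℝ, μ₀ ≤ μ → μ ≤ 1 → ∀ x p : Space N, r₀ ≤ ‖p‖ →
      (1 - μ) * (bₘ * ‖p‖ ^ m - b₀) ≤ μ * H x (μ⁻¹ • p) - H x p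

/-! ### The nonlocal operator and viscosity solutions -/

/-- `I_ξ[A](x,p,φ) = ∫_A (φ(x+z) - φ(x) - 1_B(z) p·z) ν_ξ(dz)`, where `B` is the unit ball. -/
noncomputable def levyOp {N : ℕ} (ν : Space N → Measure (Space N)) (ξ : Space N)
    (A : Set (Space N)) (x p : Space N) (φ : Space N → ℝ) : ℝ :=
  ∫ z in A, (φ (x + z) - φ x -
    (ball (0 : Space N) 1).indicator (fun w => inner ℝ p w) z) ∂(ν ξ)

/-- `λ u(x) - I[B_δ](x,φ) - I[B_δᶜ](x,Dφ(x),u) + H(x,Dφ(x))`. -/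
noncomputable def viscExpr {N : ℕ} (lam : ℝ) (ν : Space N → Measure (Space N))
    (H : Space N → Space N → ℝ) (u φ : Space N → ℝ) (x : Space N) (δ : ℝ) : ℝ :=
  lam * u x - levyOp ν x (ball 0 δ) x (gradient φ x) φ
    - levyOp ν x (ball 0 δ)ᶜ x (gradient φ x) u + H x (gradient φ x)

/-- Bounded viscosity subsolutions of `λ u - I_x u(x) + H(x,Du) = 0` in `ℝ^N`. -/
def IsViscositySubsolution {N : ℕ} (lam : ℝ) (ν : Space N → Measure (Space N))
    (H : Space N → Space N → ℝ) (u : Space N → ℝ) : Prop :=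
  UpperSemicontinuous u ∧ IsBddFun u ∧
    ∀ (φ : Space N → ℝ) (x : Space N) (δ : ℝ), 0 < δ →
      ContDiffOn ℝ 2 φ (ball x δ) → IsBddFun φ →
      (∀ y ∈ ball x δ, u y - φ y ≤ u x - φ x) →
      viscExpr lam ν H u φ x δ ≤ 0

/-- Bounded viscosity supersolutions of `λ u - I_x u(x) + H(x,Du) = 0` in `ℝ^N`. -/
def IsViscositySupersolution {N : ℕ} (lam : ℝ) (ν : Space N → Measure (Space N))
    (H : Space N → Space N → ℝ) (u : Space N → ℝ) : Prop :=
  LowerSemicontinuous u ∧ IsBddFun u ∧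
    ∀ (φ : Space N → ℝ) (x : Space N) (δ : ℝ), 0 < δ →
      ContDiffOn ℝ 2 φ (ball x δ) → IsBddFun φ →
      (∀ y ∈ ball x δ, u x - φ x ≤ u y - φ y) →
      0 ≤ viscExpr lam ν H u φ x δ

/-- Bounded continuous viscosity solutions. -/
def IsViscositySolution {N : ℕ} (lam : ℝ) (ν : Space N → Measure (Space N))
    (H : Space N → Space N → ℝ) (u : Space N → ℝ) : Prop :=
  Continuous u ∧ IsBddFun u ∧
    IsViscositySubsolution lam ν H u ∧ IsViscositySupersolution lam ν H u

end NonlocalHJ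

namespace NonlocalHJ

variable {N : ℕ}

/-! ### The Lévy weight -/

/-! Uniqueness is a comparison principle, and existence is Perron's method built on it.

Comparison (`comparison`) doubles the variables with the subsolution scaled: if `u x₀ > v x₀`,
maximize `μ u(x) - v(y) - α|x-y|² - ψ(x)` with `μ < 1` close to 1 and `ψ` a bounded localizing
function. At a maximum point put `p = 2α(x-y)`, `q = Dψ(x)`, `P = p + q`. Scaling the subsolution
turns superlinear coercivity into a gain `-(1-μ)β|P|^m` (`exists_hamiltonian_gain`), and every error
is at most `e(1+|P|^m)` with `e` as small as desired after `μ` is fixed. For the Hamiltonian this is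
(H1). For the nonlocal terms (`doubling_estimate`), small jumps are compared through a coupling and
cost about `α W₂²`; by (M4) this is at most a small multiple of `α|x-y|`, hence of `|p|`. This is
why Hölder exponent 1/2 suffices. Intermediate jumps cost `|p|` times the total variation in (M3),
and large jumps are uniformly rare by (M2). Since `m > 1`, the gain absorbs all these errors. The
penalization `α` is only taken large enough to bring `x` and `y` close; no limit `α → ∞` and no
bound on `|p|` is needed.

For existence, constants `±K` are a sub- and a supersolution, so comparison bounds all subsolutions
by `K`. The supremum of those above `-K` has an upper envelope that is again a subsolution
(`isViscositySubsolution_of_approx`), so the supremum is attained in the class and is upper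
semicontinuous. Its lower envelope is a supersolution, since otherwise a small bump would give a
larger subsolution (`isViscositySupersolution_of_maximal`). Comparison between the two makes them
equal, which gives continuity.

Both Perron steps pass to the limit in an operator whose measure moves with the point.
`eventually_integral_le` does this: (M4) makes the small jumps uniformly negligible near a point,
(M3) handles the middle range, (M2) the tail. -/

/-- The weight `min(1,|z|²)`. -/
noncomputable def levyWeight (z : Space N) : ℝ := min 1 (‖z‖ ^ 2)

lemma levyWeight_nonneg (z : Space N) : 0 ≤ levyWeight z :=
  le_min zero_le_one (by positivity)

lemma levyWeight_le_one (z : Space N) : levyWeight z ≤ 1 := min_le_left _ _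

lemma levyWeight_le_sq (z : Space N) : levyWeight z ≤ ‖z‖ ^ 2 := min_le_right _ _

lemma levyWeight_of_norm_le_one {z : Space N} (hz : ‖z‖ ≤ 1) : levyWeight z = ‖z‖ ^ 2 :=
  min_eq_right (by nlinarith [norm_nonneg z])

lemma sq_le_levyWeight {z : Space N} {s : ℝ} (hs : 0 ≤ s) (hs1 : s ≤ 1) (hz : s ≤ ‖z‖) :
    s ^ 2 ≤ levyWeight z :=
  le_min (by nlinarith) (by gcongr)

lemma continuous_levyWeight : Continuous (levyWeight (N := N)) := by
  unfold levyWeight; fun_prop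

lemma IsLevyMeasure.integrable_levyWeight {ν : Measure (Space N)} (h : IsLevyMeasure ν) :
    Integrable levyWeight ν := by
  refine ⟨continuous_levyWeight.aestronglyMeasurable, ?_⟩
  rw [hasFiniteIntegral_iff_ofReal (Eventually.of_forall levyWeight_nonneg)]
  exact h.2

/-- Measurable functions dominated by a multiple of the Lévy weight. -/
def LevyBounded (C : ℝ) (f : Space N → ℝ) : Prop :=
  Measurable f ∧ ∀ z, |f z| ≤ C * levyWeight z

lemma LevyBounded.integrable {C : ℝ} {f : Space N → ℝ} (hf : LevyBounded C f)
    {ν : Measure (Space N)} (h : IsLevyMeasure ν) : Integrable f ν :=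
  (h.integrable_levyWeight.const_mul C).mono' hf.1.aestronglyMeasurable
    (Eventually.of_forall hf.2)

/-- Needed for couplings: their marginals are prescribed only away from the origin, so only
integrands vanishing at 0 have a determined integral. -/
lemma LevyBounded.apply_zero {C : ℝ} {f : Space N → ℝ} (hf : LevyBounded C f) : f 0 = 0 := by
  have := hf.2 0
  simpa [levyWeight] using this

lemma integral_levyWeight_le {ν : Measure (Space N)} {C : ℝ} (hC : 0 ≤ C)
    (h : ∫⁻ z, ENNReal.ofReal (min 1 (‖z‖ ^ 2)) ∂ν ≤ ENNReal.ofReal C) :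
    ∫ z, levyWeight z ∂ν ≤ C := by
  rw [integral_eq_lintegral_of_nonneg_ae (Eventually.of_forall levyWeight_nonneg)
    continuous_levyWeight.aestronglyMeasurable]
  exact ENNReal.toReal_le_of_le_ofReal hC h

lemma IsLevyMeasure.measure_compl_ball_lt_top {ν : Measure (Space N)} (h : IsLevyMeasure ν)
    {r : ℝ} (hr : 0 < r) : ν (ball 0 r)ᶜ < ∞ := by
  have hs : (0:ℝ) < min r 1 ^ 2 := by positivity
  refine lt_of_le_of_lt (measure_mono ?_)
    (h.integrable_levyWeight.measure_ge_lt_top hs)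
  intro z hz
  have hz' : r ≤ ‖z‖ := by simpa using hz
  exact sq_le_levyWeight (by positivity) (min_le_right _ _) ((min_le_left _ _).trans hz')

lemma IsLevyMeasure.measureReal_le {ν : Measure (Space N)} (h : IsLevyMeasure ν)
    {r C : ℝ} (hr : 0 < r) (hr1 : r ≤ 1) (hC : ∫ z, levyWeight z ∂ν ≤ C) {A : Set (Space N)}
    (hA : A ⊆ (ball 0 r)ᶜ) : ν.real A ≤ C / r ^ 2 := by
  have h1 : ν.real A ≤ ν.real (ball 0 r)ᶜ :=
    measureReal_mono hA (h.measure_compl_ball_lt_top hr).ne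
  have h2 : r ^ 2 * ν.real (ball 0 r)ᶜ ≤ ∫ z in (ball 0 r)ᶜ, levyWeight z ∂ν := by
    have := setIntegral_mono_on (μ := ν) (s := (ball (0 : Space N) r)ᶜ) (f := fun _ => r ^ 2)
      (g := levyWeight) (by
        rw [integrableOn_const_iff]; right; exact h.measure_compl_ball_lt_top hr)
      h.integrable_levyWeight.integrableOn measurableSet_ball.compl
      (fun z hz => sq_le_levyWeight hr.le hr1 (by simpa using hz))
    simpa [mul_comm] using this
  have h3 : ∫ z in (ball 0 r)ᶜ, levyWeight z ∂ν ≤ ∫ z, levyWeight z ∂ν :=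
    setIntegral_le_integral h.integrable_levyWeight (Eventually.of_forall levyWeight_nonneg)
  rw [le_div_iff₀ (by positivity)]
  nlinarith

/-! ### Total variation -/

/-- Layer cake formula: the superlevel sets within `A` differ in measure by at most the positive
variation, and only the levels in `(0, K)` count. -/
lemma lintegral_le_add_posVariation (ν₁ ν₂ : Measure (Space N)) {A : Set (Space N)}
    (hA : MeasurableSet A) {f : Space N → ℝ} (hf : Measurable f) {K : ℝ}
    (h0 : ∀ z, 0 ≤ f z) (hK : ∀ z, f z ≤ K) :
    ∫⁻ z in A, ENNReal.ofReal (f z) ∂ν₁ ≤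
      ∫⁻ z in A, ENNReal.ofReal (f z) ∂ν₂ + ENNReal.ofReal K * posVariation ν₁ ν₂ A := by
  rw [lintegral_eq_lintegral_meas_lt _ (Eventually.of_forall h0) hf.aemeasurable,
    lintegral_eq_lintegral_meas_lt _ (Eventually.of_forall h0) hf.aemeasurable]
  have key : ∀ t : ℝ, (ν₁.restrict A) {a | t < f a} ≤ (ν₂.restrict A) {a | t < f a} +
      (Set.Iio K).indicator (fun _ => posVariation ν₁ ν₂ A) t := by
    intro t
    have hm : MeasurableSet {a | t < f a} := measurableSet_lt measurable_const hf
    by_cases ht : t < K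
    · rw [Set.indicator_of_mem (Set.mem_Iio.2 ht), Measure.restrict_apply hm,
        Measure.restrict_apply hm, add_comm, ← tsub_le_iff_right]
      exact le_iSup_of_le _ (le_iSup_of_le (hm.inter hA) (le_iSup_of_le Set.inter_subset_right
        le_rfl))
    · have : {a | t < f a} = ∅ := by
        ext a; simp only [Set.mem_ofPred_eq, Set.mem_empty_iff_false, iff_false, not_lt]
        exact (hK a).trans (not_lt.1 ht)
      simp [this]
  calc _ ≤ ∫⁻ t in Set.Ioi (0:ℝ), ((ν₂.restrict A) {a | t < f a} +
        (Set.Iio K).indicator (fun _ => posVariation ν₁ ν₂ A) t) := lintegral_mono fun t => key t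
    _ = _ := by
      rw [lintegral_add_right _ (measurable_const.indicator measurableSet_Iio),
        lintegral_indicator_const measurableSet_Iio, Measure.restrict_apply measurableSet_Iio,
        Set.Iio_inter_Ioi, Real.volume_Ioo, sub_zero, mul_comm]

/-- Shift `f` by `K` so that it takes values in `[0, 2K]` and apply the one-sided bound, which costs
`2K` times the positive variation. Undoing the shift costs `K(ν₂(A) - ν₁(A))`, at most `K` times the
opposite variation. -/
lemma setIntegral_sub_le_totalVar (ν₁ ν₂ : Measure (Space N)) {A : Set (Space N)}
    (hA : MeasurableSet A) (h₁ : ν₁ A < ∞) (h₂ : ν₂ A < ∞) {f : Space N → ℝ} (hf : Measurable f)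
    {K τ : ℝ} (hK0 : 0 ≤ K) (hτ0 : 0 ≤ τ) (hK : ∀ z ∈ A, |f z| ≤ K)
    (hτ : totalVar ν₁ ν₂ A ≤ ENNReal.ofReal τ) :
    ∫ z in A, f z ∂ν₁ - ∫ z in A, f z ∂ν₂ ≤ 2 * K * τ := by
  have hi : ∀ ν : Measure (Space N), ν A < ∞ → IntegrableOn f A ν := fun ν h => by
    have : IsFiniteMeasure (ν.restrict A) := ⟨by simpa using h⟩
    exact Integrable.of_bound hf.aestronglyMeasurable K
      ((ae_restrict_iff' hA).2 (Eventually.of_forall hK))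
  have hc : ∀ ν : Measure (Space N), ν A < ∞ → IntegrableOn (fun _ => K) A ν := fun ν h =>
    integrableOn_const h.ne
  set F : Space N → ℝ := fun z => A.indicator f z + K
  have hFm : Measurable F := (hf.indicator hA).add_const K
  have hF : ∀ z, 0 ≤ F z ∧ F z ≤ 2 * K := by
    intro z
    by_cases hz : z ∈ A
    · have := abs_le.1 (hK z hz)
      simp only [F, Set.indicator_of_mem hz]; constructor <;> linarith
    · simp only [F, Set.indicator_of_notMem hz]; constructor <;> linarith
  have hFe : ∀ ν : Measure (Space N), ν A < ∞ →
      ∫⁻ z in A, ENNReal.ofReal (F z) ∂ν = ENNReal.ofReal (∫ z in A, f z ∂ν + K * ν.real A) := by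
    intro ν h
    have e : ∫ z in A, f z ∂ν + K * ν.real A = ∫ z in A, F z ∂ν := by
      have : ∫ z in A, F z ∂ν = ∫ z in A, (f z + K) ∂ν :=
        setIntegral_congr_fun hA (fun z hz => by simp [F, Set.indicator_of_mem hz])
      rw [this, integral_add (hi ν h) (hc ν h), setIntegral_const, smul_eq_mul, mul_comm]
    rw [e, ofReal_integral_eq_lintegral_ofReal _ (Eventually.of_forall fun z => (hF z).1)]
    exact ((hi ν h).add (hc ν h)).congr ((ae_restrict_iff' hA).2 (Eventually.of_forall
      fun z hz => by simp [F, Set.indicator_of_mem hz]))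
  have hFn : ∀ ν : Measure (Space N), ν A < ∞ → 0 ≤ ∫ z in A, f z ∂ν + K * ν.real A := by
    intro ν h
    have := norm_setIntegral_le_of_norm_le_const (μ := ν) (f := f) h hK
    rw [Real.norm_eq_abs] at this
    linarith [(abs_le.1 this).1]
  set a := (posVariation ν₁ ν₂ A).toReal
  set b := (posVariation ν₂ ν₁ A).toReal
  have ha' : posVariation ν₁ ν₂ A ≠ ∞ :=
    ((le_self_add.trans hτ).trans_lt ENNReal.ofReal_lt_top).ne
  have hb' : posVariation ν₂ ν₁ A ≠ ∞ :=
    ((le_add_self.trans hτ).trans_lt ENNReal.ofReal_lt_top).ne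
  have hab : a + b ≤ τ := by
    rw [← ENNReal.toReal_add ha' hb']
    exact ENNReal.toReal_le_of_le_ofReal hτ0 hτ
  have ha0 : 0 ≤ a := ENNReal.toReal_nonneg
  have hb0 : 0 ≤ b := ENNReal.toReal_nonneg
  have h1 : ∫ z in A, f z ∂ν₁ + K * ν₁.real A ≤ ∫ z in A, f z ∂ν₂ + K * ν₂.real A + 2 * K * a := by
    have := lintegral_le_add_posVariation ν₁ ν₂ hA hFm (fun z => (hF z).1) (fun z => (hF z).2)
    rw [hFe _ h₁, hFe _ h₂, ← ENNReal.ofReal_toReal ha', ← ENNReal.ofReal_mul (by positivity),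
      ← ENNReal.ofReal_add (hFn _ h₂) (by positivity)] at this
    exact (ENNReal.ofReal_le_ofReal_iff (add_nonneg (hFn _ h₂) (by positivity))).1 this
  have h2 : ν₂.real A ≤ ν₁.real A + b := by
    have : ν₂ A - ν₁ A ≤ posVariation ν₂ ν₁ A :=
      le_iSup_of_le A (le_iSup_of_le hA (le_iSup_of_le subset_rfl le_rfl))
    rw [tsub_le_iff_right, add_comm] at this
    have := ENNReal.toReal_mono (ENNReal.add_ne_top.2 ⟨h₁.ne, hb'⟩) this
    rwa [ENNReal.toReal_add h₁.ne hb'] at this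
  nlinarith

/-! ### Couplings -/

lemma Admissible.ae_mem {A : Set (Space N)} {ν₁ ν₂ : Measure (Space N)}
    {γ : Measure (Space N × Space N)} (h : γ ∈ Admissible A ν₁ ν₂) : ∀ᵐ z ∂γ, z ∈ A ×ˢ A :=
  h.1

/-- The first marginal of `γ` may carry arbitrary, even infinite, mass at the origin; `f 0 = 0`
makes that mass invisible. -/
lemma Admissible.integrable_fst {A : Set (Space N)} (hA : MeasurableSet A)
    {ν₁ ν₂ : Measure (Space N)} {γ : Measure (Space N × Space N)} (h : γ ∈ Admissible A ν₁ ν₂)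
    {f : Space N → ℝ} (hf : Measurable f) (h0 : f 0 = 0) (hi : Integrable f ν₁) :
    Integrable (fun z : Space N × Space N => f z.1) γ ∧
      ∫ z, f z.1 ∂γ = ∫ z, f z ∂ν₁ := by
  have hB : MeasurableSet (A \ {0}) := hA.diff (measurableSet_singleton 0)
  have hae : ∀ᵐ z : Space N × Space N ∂γ, z ∉ Prod.fst ⁻¹' (A \ {0}) → f z.1 = 0 := by
    filter_upwards [Admissible.ae_mem h] with z hz hz'
    by_cases e : z.1 = 0
    · rw [e, h0]
    · exact absurd ⟨hz.1, e⟩ hz'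
  rw [← h.2.2.1, Measure.restrict_map measurable_fst hB] at hi ⊢
  have hi' := (integrable_map_measure hf.aestronglyMeasurable measurable_fst.aemeasurable).1 hi
  rw [integral_map measurable_fst.aemeasurable hf.aestronglyMeasurable]
  have hi2 : IntegrableOn (fun z : Space N × Space N => f z.1) (Prod.fst ⁻¹' (A \ {0})) γ := hi'
  exact ⟨hi2.integrable_of_ae_notMem_eq_zero hae,
    (setIntegral_eq_integral_of_ae_compl_eq_zero hae).symm⟩

lemma Admissible.swap {A : Set (Space N)} {ν₁ ν₂ : Measure (Space N)}
    {γ : Measure (Space N × Space N)} (hA : MeasurableSet A) (h : γ ∈ Admissible A ν₁ ν₂) :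
    γ.map Prod.swap ∈ Admissible A ν₂ ν₁ := by
  refine ⟨?_, ?_, ?_, ?_⟩
  · rw [Measure.map_apply measurable_swap (hA.prod hA).compl, Set.preimage_compl,
      Set.preimage_swap_prod]
    exact h.1
  · rw [Measure.map_apply measurable_swap (measurableSet_singleton _)]
    convert h.2.1 using 2
    ext ⟨a, b⟩
    simp [and_comm]
  · rw [Measure.map_map measurable_fst measurable_swap]
    exact h.2.2.2
  · rw [Measure.map_map measurable_snd measurable_swap]
    exact h.2.2.1

lemma Admissible.integrable_snd {A : Set (Space N)} (hA : MeasurableSet A)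
    {ν₁ ν₂ : Measure (Space N)} {γ : Measure (Space N × Space N)} (h : γ ∈ Admissible A ν₁ ν₂)
    {f : Space N → ℝ} (hf : Measurable f) (h0 : f 0 = 0) (hi : Integrable f ν₂) :
    Integrable (fun z : Space N × Space N => f z.2) γ ∧
      ∫ z, f z.2 ∂γ = ∫ z, f z ∂ν₂ := by
  obtain ⟨h1, h2⟩ := Admissible.integrable_fst hA (Admissible.swap hA h) hf h0 hi
  have hm : Measurable fun z : Space N × Space N => f z.1 := hf.comp measurable_fst
  rw [integrable_map_measure hm.aestronglyMeasurable measurable_swap.aemeasurable] at h1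
  rw [integral_map measurable_swap.aemeasurable hm.aestronglyMeasurable] at h2
  exact ⟨h1, h2⟩

/-- The infimum over couplings is not claimed to be attained, hence the slack `η`. -/
lemma exists_coupling {ν₁ ν₂ : Measure (Space N)} {r c η : ℝ} (hc : 0 ≤ c) (hη : 0 < η)
    (h : wasserstein2 ν₁ ν₂ r ≤ ENNReal.ofReal c) :
    ∃ γ ∈ Admissible (ball (0 : Space N) r) (ν₁.restrict (ball 0 r)) (ν₂.restrict (ball 0 r)),
      Integrable (fun z : Space N × Space N => ‖z.1 - z.2‖ ^ 2) γ ∧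
        ∫ z, ‖z.1 - z.2‖ ^ 2 ∂γ ≤ c ^ 2 + η := by
  unfold wasserstein2 at h
  rw [one_div, ENNReal.rpow_inv_le_iff (by norm_num),
    ENNReal.ofReal_rpow_of_nonneg hc (by norm_num)] at h
  have h' := h.trans_lt ((ENNReal.ofReal_lt_ofReal_iff (by positivity)).2
    (show c ^ (2:ℝ) < c ^ (2:ℝ) + η by linarith))
  simp only [iInf_lt_iff] at h'
  obtain ⟨γ, hγ, hlt⟩ := h'
  have hm : Measurable fun z : Space N × Space N => ‖z.1 - z.2‖ ^ 2 := by fun_prop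
  have hr : γ.restrict (ball (0 : Space N) r ×ˢ ball (0 : Space N) r) = γ :=
    Measure.restrict_eq_self_of_ae_mem (Admissible.ae_mem hγ)
  rw [hr, Real.rpow_two] at hlt
  refine ⟨γ, hγ, ⟨hm.aestronglyMeasurable, ?_⟩, ?_⟩
  · rw [hasFiniteIntegral_iff_ofReal (Eventually.of_forall fun z => by positivity)]
    exact hlt.trans ENNReal.ofReal_lt_top
  · rw [integral_eq_lintegral_of_nonneg_ae (Eventually.of_forall fun z => by positivity)
      hm.aestronglyMeasurable]
    exact ENNReal.toReal_le_of_le_ofReal (by positivity) hlt.le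

/-! ### Quantitative forms of the assumptions on the measures -/

lemma IsModulus.exists_lt {ω : ℝ≥0 → ℝ≥0} (h : IsModulus ω) {η : ℝ} (hη : 0 < η) :
    ∃ s > 0, ∀ t : ℝ≥0, (t : ℝ) < s → (ω t : ℝ) < η := by
  have h1 : ∀ᶠ t in 𝓝 (0 : ℝ≥0), ω t < η.toNNReal :=
    h.eventually (gt_mem_nhds (Real.toNNReal_pos.2 hη))
  obtain ⟨s, hs, h2⟩ := Metric.eventually_nhds_iff.1 h1
  refine ⟨s, hs, fun t ht => ?_⟩
  have := h2 (y := t) (by simpa [NNReal.dist_eq] using ht)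
  simpa [Real.lt_toNNReal_iff_coe_lt] using this

lemma AssumptionM1.exists_bound {ν : Space N → Measure (Space N)} (h : AssumptionM1 ν) :
    ∃ C > 0, ∀ ξ, ∫ z, levyWeight z ∂(ν ξ) ≤ C := by
  obtain ⟨C, hC, h⟩ := h
  exact ⟨C, hC, fun ξ => integral_levyWeight_le hC.le (h ξ)⟩

lemma AssumptionM2.exists_radius {ν : Space N → Measure (Space N)} (h : AssumptionM2 ν) {η : ℝ}
    (hη : 0 < η) : ∃ R > 1, ∀ ξ, (ν ξ).real (ball 0 R)ᶜ ≤ η := by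
  have h1 : ∀ᶠ R : ℝ in atTop, ⨆ ξ, ν ξ (ball (0 : Space N) R)ᶜ < ENNReal.ofReal η :=
    h.eventually (gt_mem_nhds (ENNReal.ofReal_pos.2 hη))
  obtain ⟨R, h2, h3⟩ := (h1.and (eventually_gt_atTop 1)).exists
  exact ⟨R, h3, fun ξ => ENNReal.toReal_le_of_le_ofReal hη.le
    ((le_iSup (fun ξ => ν ξ (ball (0 : Space N) R)ᶜ) ξ).trans h2.le)⟩

lemma AssumptionM3.exists_dist {ν : Space N → Measure (Space N)} (h : AssumptionM3 ν) {r R η : ℝ}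
    (hr : 0 < r) (hR : r < R) (hη : 0 < η) :
    ∃ s > 0, ∀ x y, ‖x - y‖ < s →
      totalVar (ν x) (ν y) (ball 0 R \ ball 0 r) ≤ ENNReal.ofReal η := by
  obtain ⟨ω, hω, h⟩ := h r R hr hR
  obtain ⟨s, hs, h'⟩ := hω.exists_lt hη
  refine ⟨s, hs, fun x y hxy => (h x y).trans ?_⟩
  rw [← ENNReal.ofReal_coe_nnreal]
  exact ENNReal.ofReal_le_ofReal (h' _ (by simpa using hxy)).le

/-- Squaring the 1/2-Hölder bound makes the transport cost linear in `|x - y|`, the scale on which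
`α` times the cost is comparable with the momentum `2α|x - y|`. The slack `κ` covers near-optimal
couplings. -/
lemma AssumptionM4.exists_radius {ν : Space N → Measure (Space N)} (h : AssumptionM4 ν) {η : ℝ}
    (hη : 0 < η) : ∃ ρ > 0, ρ < 1 ∧ ∀ r, 0 < r → r < ρ → ∀ x y, ∀ κ > 0,
      ∃ γ ∈ Admissible (ball (0 : Space N) r) ((ν x).restrict (ball 0 r))
          ((ν y).restrict (ball 0 r)),
        Integrable (fun z : Space N × Space N => ‖z.1 - z.2‖ ^ 2) γ ∧
          ∫ z, ‖z.1 - z.2‖ ^ 2 ∂γ ≤ η * ‖x - y‖ + κ := by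
  obtain ⟨r₀, h0, h1, g, hg, h⟩ := h
  have hη' : (0 : ℝ≥0) < (Real.sqrt η).toNNReal := Real.toNNReal_pos.2 (Real.sqrt_pos.2 hη)
  have h2 : ∀ᶠ r in 𝓝[>] (0:ℝ), g r < (Real.sqrt η).toNNReal := hg.eventually (gt_mem_nhds hη')
  obtain ⟨t, ht, h3⟩ := mem_nhdsGT_iff_exists_Ioo_subset.1 h2
  refine ⟨min t r₀, lt_min ht h0, (min_le_right _ _).trans_lt h1, fun r hr hrt x y κ hκ => ?_⟩
  obtain ⟨γ, hγ, hi, hle⟩ := exists_coupling (by positivity) hκ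
    (h r hr (hrt.trans_le (min_le_right _ _)) x y)
  refine ⟨γ, hγ, hi, hle.trans ?_⟩
  have hgr : (g r : ℝ) ^ 2 ≤ η := by
    have h4 : g r < (Real.sqrt η).toNNReal := h3 ⟨hr, hrt.trans_le (min_le_left _ _)⟩
    rw [Real.lt_toNNReal_iff_coe_lt] at h4
    calc (g r : ℝ) ^ 2 ≤ Real.sqrt η ^ 2 := by gcongr
      _ = η := Real.sq_sqrt hη.le
  have e : (g r * ‖x - y‖ ^ (1 / 2 : ℝ)) ^ 2 = (g r : ℝ) ^ 2 * ‖x - y‖ := by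
    rw [mul_pow, ← Real.sqrt_eq_rpow, Real.sq_sqrt (norm_nonneg _)]
  rw [e]
  gcongr

lemma IsLevyMeasure.tendsto_setIntegral_ball {ν : Measure (Space N)} (h : IsLevyMeasure ν) :
    Tendsto (fun r : ℝ => ∫ z in ball 0 r, levyWeight z ∂ν) (𝓝[>] 0) (𝓝 0) := by
  have h1 : ∀ r : ℝ, ∫ z in ball 0 r, levyWeight z ∂ν =
      ∫ z, (ball 0 r).indicator levyWeight z ∂ν := fun r =>
    (integral_indicator measurableSet_ball).symm
  simp only [h1]
  have h2 : ∫ _ : Space N, (0:ℝ) ∂ν = 0 := integral_zero _ _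
  rw [show 𝓝 (0:ℝ) = 𝓝 (∫ _ : Space N, (0:ℝ) ∂ν) by rw [h2]]
  refine tendsto_integral_filter_of_dominated_convergence levyWeight ?_ ?_
    h.integrable_levyWeight ?_
  · exact Eventually.of_forall fun r =>
      (continuous_levyWeight.measurable.indicator measurableSet_ball).aestronglyMeasurable
  · refine Eventually.of_forall fun r => Eventually.of_forall fun z => ?_
    rw [Real.norm_eq_abs, abs_of_nonneg (Set.indicator_nonneg (fun z _ => levyWeight_nonneg z) z)]
    exact Set.indicator_le_self' (fun _ _ => levyWeight_nonneg _) z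
  · refine Eventually.of_forall fun z => ?_
    by_cases hz : z = 0
    · have : ∀ r : ℝ, (ball (0 : Space N) r).indicator levyWeight z = 0 := fun r => by
        rw [hz]; simp [Set.indicator, levyWeight]
      simp only [this]
      exact tendsto_const_nhds
    · refine tendsto_const_nhds.congr' ?_
      filter_upwards [nhdsWithin_le_nhds (gt_mem_nhds (norm_pos_iff.2 hz))] with r hr
      rw [Set.indicator_of_notMem]
      simpa using hr.le

/-- Uniform smallness of the small jumps near `x`: fix `r` by dominated convergence for `ν x`, then
transfer to `ν y` along a coupling through `|z₁|² ≤ 2|z₁ - z₂|² + 2|z₂|²`. The transport cost is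
small because `y` is close to `x`, so (M4) with constant 1 is enough. -/
lemma exists_ball_integral_le {ν : Space N → Measure (Space N)} (hν : ∀ ξ, IsLevyMeasure (ν ξ))
    (hM4 : AssumptionM4 ν) (x : Space N) {η : ℝ} (hη : 0 < η) :
    ∃ r > 0, r < 1 ∧ ∀ᶠ y in 𝓝 x, ∫ z in ball 0 r, levyWeight z ∂(ν y) ≤ η := by
  obtain ⟨ρ, hρ, hρ1, h4⟩ := hM4.exists_radius zero_lt_one
  have h1 : ∀ᶠ r in 𝓝[>] (0:ℝ), ∫ z in ball 0 r, levyWeight z ∂(ν x) < η / 8 :=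
    (hν x).tendsto_setIntegral_ball.eventually (gt_mem_nhds (by positivity))
  obtain ⟨r, hr, hr0, hrρ⟩ := (h1.and (Ioo_mem_nhdsGT hρ)).exists
  refine ⟨r, hr0, hrρ.trans hρ1, ?_⟩
  filter_upwards [ball_mem_nhds x (show 0 < η / 8 by positivity)] with y hy
  obtain ⟨γ, hγ, hi, hle⟩ := h4 r hr0 hrρ y x (η / 8) (by positivity)
  have hw0 : levyWeight (0 : Space N) = 0 := by simp [levyWeight]
  obtain ⟨i1, e1⟩ := Admissible.integrable_fst measurableSet_ball hγ
    continuous_levyWeight.measurable hw0 (hν y).integrable_levyWeight.integrableOn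
  obtain ⟨i2, e2⟩ := Admissible.integrable_snd measurableSet_ball hγ
    continuous_levyWeight.measurable hw0 (hν x).integrable_levyWeight.integrableOn
  rw [← e1]
  have hmono : ∫ z, levyWeight z.1 ∂γ ≤ ∫ z, (2 * ‖z.1 - z.2‖ ^ 2 + 2 * levyWeight z.2) ∂γ := by
    refine integral_mono_ae i1 ((hi.const_mul 2).add (i2.const_mul 2)) ?_
    filter_upwards [Admissible.ae_mem hγ] with z hz
    have hz2 : ‖z.2‖ ≤ 1 := by
      have := hz.2; rw [mem_ball_zero_iff] at this; linarith
    have hz1 : ‖z.1‖ ≤ ‖z.1 - z.2‖ + ‖z.2‖ := by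
      simpa using norm_add_le (z.1 - z.2) z.2
    have := levyWeight_le_sq z.1
    show levyWeight z.1 ≤ 2 * ‖z.1 - z.2‖ ^ 2 + 2 * levyWeight z.2
    rw [levyWeight_of_norm_le_one hz2]
    nlinarith [norm_nonneg z.1, norm_nonneg z.2, norm_nonneg (z.1 - z.2),
      sq_nonneg (‖z.1 - z.2‖ - ‖z.2‖)]
  rw [integral_add (hi.const_mul 2) (i2.const_mul 2), integral_const_mul, integral_const_mul,
    e2] at hmono
  rw [mem_ball_iff_norm] at hy
  linarith

lemma abs_setIntegral_le_levyWeight {ν : Measure (Space N)} (h : IsLevyMeasure ν) {C : ℝ}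
    {f : Space N → ℝ} (hf : LevyBounded C f) (A : Set (Space N)) :
    |∫ z in A, f z ∂ν| ≤ C * ∫ z in A, levyWeight z ∂ν := by
  rw [← integral_const_mul]
  rw [← Real.norm_eq_abs]
  exact norm_integral_le_of_norm_le (h.integrable_levyWeight.const_mul C).integrableOn
    (Eventually.of_forall hf.2)

lemma setIntegral_levyWeight_le {ν : Measure (Space N)} {A : Set (Space N)}
    (h : ν A < ∞) : ∫ z in A, levyWeight z ∂ν ≤ ν.real A := by
  have := norm_setIntegral_le_of_norm_le_const (μ := ν) (f := levyWeight) (C := 1) h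
    (fun z _ => by
      rw [Real.norm_eq_abs, abs_of_nonneg (levyWeight_nonneg z)]; exact levyWeight_le_one z)
  rw [one_mul] at this
  exact (le_abs_self _).trans this

lemma integral_split {ν : Measure (Space N)} {f : Space N → ℝ} (hf : Integrable f ν) {r R : ℝ}
    (hrR : r ≤ R) : ∫ z, f z ∂ν = ∫ z in ball 0 r, f z ∂ν +
      ∫ z in ball 0 R \ ball 0 r, f z ∂ν + ∫ z in (ball 0 R)ᶜ, f z ∂ν := by
  rw [← integral_add_compl (measurableSet_ball (x := (0 : Space N)) (ε := R)) hf,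
    ← setIntegral_union Set.disjoint_sdiff_right (measurableSet_ball.diff measurableSet_ball)
      hf.integrableOn hf.integrableOn, Set.union_sdiff_cancel (ball_subset_ball hrR)]

/-- Upper semicontinuity of the integral with respect to the base point of the Lévy measure. -/
lemma eventually_integral_le {ν : Space N → Measure (Space N)} (hν : ∀ ξ, IsLevyMeasure (ν ξ))
    (hM2 : AssumptionM2 ν) (hM3 : AssumptionM3 ν) (hM4 : AssumptionM4 ν)
    {ι : Type*} {l : Filter ι} [l.IsCountablyGenerated] {y : ι → Space N} {x : Space N}
    (hy : Tendsto y l (𝓝 x)) {C : ℝ} (hC : 0 < C) {F : ι → Space N → ℝ} {G : Space N → ℝ}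
    (hF : ∀ᶠ i in l, LevyBounded C (F i)) (hG : LevyBounded C G)
    (hFG : ∀ z, ∀ η > 0, ∀ᶠ i in l, F i z ≤ G z + η) {η : ℝ} (hη : 0 < η) :
    ∀ᶠ i in l, ∫ z, F i z ∂(ν (y i)) ≤ ∫ z, G z ∂(ν x) + η := by
  -- Error budget: `η/8` for each of `F` and `G` on the small ball and on the tail, `2Cκ = η/4` for
  -- total variation, and `η/8` for the limit on `A`; altogether `7η/8`.
  set κ := η / (8 * C) with hκ
  have hκ0 : 0 < κ := by positivity
  have hκC : C * κ = η / 8 := by rw [hκ]; field_simp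
  obtain ⟨r, hr0, hr1, hr⟩ := exists_ball_integral_le hν hM4 x hκ0
  obtain ⟨R, hR1, hR⟩ := hM2.exists_radius hκ0
  have hrR : r < R := hr1.trans hR1
  obtain ⟨s, hs, hTV⟩ := hM3.exists_dist hr0 hrR hκ0
  set A : Set (Space N) := ball 0 R \ ball 0 r with hA
  have hAm : MeasurableSet A := measurableSet_ball.diff measurableSet_ball
  have hAfin : ∀ ξ, ν ξ A < ∞ := fun ξ =>
    (measure_mono (fun z hz => hz.2)).trans_lt ((hν ξ).measure_compl_ball_lt_top hr0)
  have hAx : IsFiniteMeasure ((ν x).restrict A) := ⟨by simpa using hAfin x⟩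
  -- The pointwise hypothesis is one-sided, so only the positive part of `F i - G` tends to 0. On
  -- `A`, which has finite `ν x` measure, it is dominated by the constant `2C`.
  have hlim : Tendsto (fun i => ∫ z in A, max (F i z - G z) 0 ∂(ν x)) l (𝓝 0) := by
    have h0 : ∫ _ in A, (0:ℝ) ∂(ν x) = 0 := by simp
    rw [show 𝓝 (0:ℝ) = 𝓝 (∫ _ in A, (0:ℝ) ∂(ν x)) by rw [h0]]
    refine tendsto_integral_filter_of_dominated_convergence (fun _ => 2 * C) ?_ ?_
      (integrable_const _) ?_
    · filter_upwards [hF] with i hi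
      exact ((hi.1.sub hG.1).max measurable_const).aestronglyMeasurable
    · filter_upwards [hF] with i hi
      refine Eventually.of_forall fun z => ?_
      have h1 := abs_le.1 (hi.2 z)
      have h2 := abs_le.1 (hG.2 z)
      have h3 := levyWeight_le_one z
      have h4 : C * levyWeight z ≤ C := by nlinarith
      rw [Real.norm_eq_abs, abs_of_nonneg (le_max_right _ _)]
      exact max_le (by linarith) (by linarith)
    · refine Eventually.of_forall fun z => ?_
      rw [Metric.tendsto_nhds]
      intro e he
      filter_upwards [hFG z (e / 2) (by positivity)] with i hi
      rw [Real.dist_eq, sub_zero, abs_of_nonneg (le_max_right _ _)]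
      exact max_lt (by linarith) he
  filter_upwards [hF, hy.eventually hr, hlim.eventually (gt_mem_nhds (show 0 < η / 8 by positivity)),
    hy.eventually (ball_mem_nhds x hs)] with i hi h1 h2 h3
  rw [dist_eq_norm] at h3
  have hbr := (abs_le.1 (abs_setIntegral_le_levyWeight (hν (y i)) hi (ball 0 r))).2
  have hbR := (abs_le.1 (abs_setIntegral_le_levyWeight (hν (y i)) hi (ball 0 R)ᶜ)).2
  have gbr := (abs_le.1 (abs_setIntegral_le_levyWeight (hν x) hG (ball 0 r))).1
  have gbR := (abs_le.1 (abs_setIntegral_le_levyWeight (hν x) hG (ball 0 R)ᶜ)).1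
  have wR : ∀ ξ, ∫ z in (ball 0 R)ᶜ, levyWeight z ∂(ν ξ) ≤ κ := fun ξ =>
    (setIntegral_levyWeight_le ((hν ξ).measure_compl_ball_lt_top (by linarith))).trans (hR ξ)
  have wr := hr.self_of_nhds
  have b1 : C * ∫ z in ball 0 r, levyWeight z ∂(ν (y i)) ≤ η / 8 := by
    rw [← hκC]; gcongr
  have b2 : C * ∫ z in ball 0 r, levyWeight z ∂(ν x) ≤ η / 8 := by
    rw [← hκC]; gcongr
  have b3 : C * ∫ z in (ball 0 R)ᶜ, levyWeight z ∂(ν (y i)) ≤ η / 8 := by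
    rw [← hκC]; gcongr; exact wR _
  have b4 : C * ∫ z in (ball 0 R)ᶜ, levyWeight z ∂(ν x) ≤ η / 8 := by
    rw [← hκC]; gcongr; exact wR _
  have tv := setIntegral_sub_le_totalVar (ν (y i)) (ν x) hAm (hAfin _) (hAfin _) hi.1 hC.le hκ0.le
    (fun z _ => (hi.2 z).trans (by nlinarith [levyWeight_le_one z])) (hTV _ _ h3)
  have hFi := hi.integrable (hν x)
  have hGi := hG.integrable (hν x)
  have mid : ∫ z in A, F i z ∂(ν x) ≤ ∫ z in A, G z ∂(ν x) +
      ∫ z in A, max (F i z - G z) 0 ∂(ν x) := by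
    have im : Integrable (fun z => max (F i z - G z) 0) (ν x) := (hFi.sub hGi).pos_part
    rw [← integral_add hGi.integrableOn im.integrableOn]
    refine integral_mono hFi.integrableOn (hGi.integrableOn.add im.integrableOn) fun z => ?_
    have := le_max_left (F i z - G z) 0
    show F i z ≤ G z + max (F i z - G z) 0
    linarith
  rw [integral_split (hi.integrable (hν (y i))) hrR.le, integral_split hGi hrR.le]
  have : 2 * C * κ = η / 4 := by rw [mul_assoc, hκC]; ring
  linarith

/-! ### Gradients and Taylor expansions -/

lemma hasGradientAt_mul_norm_sub_sq (c y : Space N) (η : ℝ) :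
    HasGradientAt (fun y : Space N => η * ‖y - c‖ ^ 2) ((2 * η) • (y - c)) y := by
  rw [hasGradientAt_iff_hasFDerivAt]
  refine ((((hasFDerivAt_id y).sub_const c).norm_sq).const_mul η).congr_fderiv ?_
  ext v
  simp
  ring

lemma hasGradientAt_add {f g : Space N → ℝ} {p q x : Space N} (hf : HasGradientAt f p x)
    (hg : HasGradientAt g q x) : HasGradientAt (fun y => f y + g y) (p + q) x := by
  rw [hasGradientAt_iff_hasFDerivAt] at *
  exact (hf.add hg).congr_fderiv (map_add _ _ _).symm

lemma hasGradientAt_const_mul {f : Space N → ℝ} {p x : Space N} (c : ℝ)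
    (hf : HasGradientAt f p x) : HasGradientAt (fun y => c * f y) (c • p) x := by
  rw [hasGradientAt_iff_hasFDerivAt] at *
  refine (hf.const_mul c).congr_fderiv ?_
  ext v
  simp

lemma gradient_eq_of_isLocalMax_sub {f g : Space N → ℝ} {x : Space N}
    (hf : DifferentiableAt ℝ f x) (hg : DifferentiableAt ℝ g x)
    (h : IsLocalMax (fun y => f y - g y) x) : gradient f x = gradient g x := by
  have := h.fderiv_eq_zero
  rw [fderiv_fun_sub hf hg, sub_eq_zero] at this
  rw [gradient, gradient, this]

lemma continuousAt_gradient {φ : Space N → ℝ} {x : Space N} (h : ContDiffAt ℝ 2 φ x) :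
    ContinuousAt (gradient φ) x := by
  have h1 : ContinuousAt (fderiv ℝ φ) x :=
    (h.fderiv_right (m := 1) (by norm_num)).continuousAt
  exact (InnerProductSpace.toDual ℝ (Space N)).symm.continuous.continuousAt.comp h1

/-- The derivative of a `C²` function is locally Lipschitz, so the mean value inequality along the
segment gives a constant uniform in the base point `y`. The uniformity is used when test points
move. -/
lemma exists_taylor_bound {φ : Space N → ℝ} {x : Space N} (h : ContDiffAt ℝ 2 φ x) :
    ∃ ρ > 0, ∃ C ≥ 0, ∀ y z, y ∈ ball x ρ → y + z ∈ ball x ρ →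
      |φ (y + z) - φ y - inner ℝ (gradient φ y) z| ≤ C * ‖z‖ ^ 2 := by
  obtain ⟨K, t, ht, hK⟩ := (h.fderiv_right (m := 1) (by norm_num)).exists_lipschitzOnWith
  have hd : ∀ᶠ y in 𝓝 x, DifferentiableAt ℝ φ y := by
    filter_upwards [h.eventually (by simp)] with y hy using hy.differentiableAt (by simp)
  obtain ⟨ρ, hρ, hb⟩ := Metric.mem_nhds_iff.1 (inter_mem ht hd)
  refine ⟨ρ, hρ, K, K.2, fun y z hy hz => ?_⟩
  have hseg : segment ℝ y (y + z) ⊆ ball x ρ := (convex_ball x ρ).segment_subset hy hz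
  have := Convex.norm_image_sub_le_of_norm_hasFDerivWithin_le' (f := φ) (f' := fderiv ℝ φ)
    (φ := fderiv ℝ φ y) (C := K * ‖z‖) (s := segment ℝ y (y + z)) (x := y) (y := y + z)
    (fun w hw => (hb (hseg hw)).2.hasFDerivAt.hasFDerivWithinAt)
    (fun w hw => by
      refine (hK.norm_sub_le (hb (hseg hw)).1 (hb hy).1).trans ?_
      gcongr
      have := norm_sub_le_of_mem_segment hw
      simpa using this)
    (convex_segment _ _) (left_mem_segment _ _ _) (right_mem_segment _ _ _)
  rw [Real.norm_eq_abs, add_sub_cancel_left] at this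
  rw [pow_two, ← mul_assoc]
  convert this using 3
  rw [inner_gradient_left]

/-! ### The integrand of the nonlocal operator -/

/-- The integrand of the nonlocal operator, with the test function `φ` inside the ball of radius
`s`, and the function `u`, normalized by the value `a`, outside. -/
noncomputable def jump (u φ : Space N → ℝ) (a : ℝ) (x p : Space N) (s : ℝ) (z : Space N) : ℝ :=
  (if ‖z‖ < s then φ (x + z) - φ x else u (x + z) - a) -
    (ball (0 : Space N) 1).indicator (fun w => inner ℝ p w) z

lemma abs_indicator_inner_le (p z : Space N) :
    |(ball (0 : Space N) 1).indicator (fun w => inner ℝ p w) z| ≤ ‖p‖ := by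
  by_cases hz : z ∈ ball (0 : Space N) 1
  · rw [Set.indicator_of_mem hz]
    rw [mem_ball_zero_iff] at hz
    exact (abs_real_inner_le_norm p z).trans (mul_le_of_le_one_right (norm_nonneg p) hz.le)
  · rw [Set.indicator_of_notMem hz]
    simp

lemma measurable_jump {u φ : Space N → ℝ} (a : ℝ) {x : Space N} (p : Space N) {δ : ℝ}
    (hu : Measurable u) (hφ : ContinuousOn φ (ball x δ)) : Measurable (jump u φ a x p δ) := by
  unfold jump
  refine Measurable.sub ?_ (Measurable.indicator (by fun_prop) measurableSet_ball)
  have h1 : Measurable fun z => (if ‖z‖ < δ then φ (x + z) - φ x else 0) := by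
    classical
    have := ContinuousOn.measurable_piecewise (f := fun z => φ (x + z) - φ x)
      (g := fun _ : Space N => (0:ℝ)) (s := ball 0 δ) (ContinuousOn.sub (hφ.comp (by fun_prop)
        (fun z hz => by simpa using hz)) continuousOn_const) continuousOn_const measurableSet_ball
    convert this using 2 with z
    simp [Set.piecewise]
  have h2 : Measurable fun z => (if ‖z‖ < δ then φ (x + z) - φ x else u (x + z) - a) := by
    have h3 : Measurable fun z => (if ‖z‖ < δ then (if ‖z‖ < δ then φ (x + z) - φ x else 0)
        else u (x + z) - a) :=
      Measurable.ite (measurableSet_lt (by fun_prop) measurable_const) h1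
        ((hu.comp (measurable_const_add x)).sub_const a)
    convert h3 using 2 with z
    split_ifs <;> rfl
  exact h2

/-- Inside radius `s` the Taylor bound gives `C|z|²`. Outside, the integrand is at most `2K + P`
while the weight is at least `s²`. The constant is uniform over the data, so it dominates whole
families. -/
lemma levyBounded_jump {u φ : Space N → ℝ} {a : ℝ} {x p : Space N} {δ s K P C : ℝ}
    (hu : Measurable u) (hφ : ContinuousOn φ (ball x δ)) (huK : ∀ y, |u y| ≤ K) (ha : |a| ≤ K)
    (hφK : ∀ y ∈ ball x δ, |φ y| ≤ K) (hp : ‖p‖ ≤ P) (hs : 0 < s) (hs1 : s ≤ 1) (hsδ : s ≤ δ)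
    (hC : 0 ≤ C) (hT : ∀ z, ‖z‖ < s → |φ (x + z) - φ x - inner ℝ p z| ≤ C * ‖z‖ ^ 2) :
    LevyBounded (C + (2 * K + P) / s ^ 2) (jump u φ a x p δ) := by
  refine ⟨measurable_jump a p hu hφ, fun z => ?_⟩
  have hK : 0 ≤ K := (abs_nonneg _).trans ha
  have hP : 0 ≤ P := (norm_nonneg _).trans hp
  have hD : 0 ≤ (2 * K + P) / s ^ 2 := by positivity
  by_cases hz : ‖z‖ < s
  · have hz1 : ‖z‖ < 1 := hz.trans_le hs1
    rw [jump, if_pos (hz.trans_le hsδ), Set.indicator_of_mem (by simpa using hz1),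
      levyWeight_of_norm_le_one hz1.le]
    refine (hT z hz).trans ?_
    gcongr
    linarith
  · have hw := sq_le_levyWeight hs.le hs1 (not_lt.1 hz)
    have h1 : (2 * K + P) ≤ (2 * K + P) / s ^ 2 * levyWeight z := by
      rw [div_mul_eq_mul_div, le_div_iff₀ (by positivity)]
      gcongr
    have h2 : |if ‖z‖ < δ then φ (x + z) - φ x else u (x + z) - a| ≤ 2 * K := by
      split_ifs with h
      · have h3 := hφK (x + z) (by simpa using h)
        have h4 := hφK x (mem_ball_self (hs.trans_le hsδ))
        linarith [abs_sub (φ (x + z)) (φ x)]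
      · linarith [abs_sub (u (x + z)) a, huK (x + z)]
    have h3 := abs_indicator_inner_le p z
    have h4 : |jump u φ a x p δ z| ≤ 2 * K + P := by
      unfold jump
      linarith [abs_sub (if ‖z‖ < δ then φ (x + z) - φ x else u (x + z) - a)
        ((ball (0 : Space N) 1).indicator (fun w => inner ℝ p w) z)]
    nlinarith [mul_nonneg hC (levyWeight_nonneg z)]

lemma exists_levyBounded_jump {u φ : Space N → ℝ} (a : ℝ) {x : Space N} {δ : ℝ}
    (hδ : 0 < δ) (hu : Measurable u) (huK : IsBddFun u) (hφ : ContDiffOn ℝ 2 φ (ball x δ))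
    (hφK : ∃ K, ∀ y ∈ ball x δ, |φ y| ≤ K) :
    ∃ C, LevyBounded C (jump u φ a x (gradient φ x) δ) := by
  obtain ⟨K₁, hK₁⟩ := huK
  obtain ⟨K₂, hK₂⟩ := hφK
  obtain ⟨ρ, hρ, C, hC, hT⟩ := exists_taylor_bound
    (hφ.contDiffAt (ball_mem_nhds x hδ))
  refine ⟨_, levyBounded_jump (K := max (max K₁ K₂) |a|) (P := ‖gradient φ x‖)
    (s := min ρ (min 1 δ)) hu hφ.continuousOn
    (fun y => (hK₁ y).trans ((le_max_left _ _).trans (le_max_left _ _))) (le_max_right _ _)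
    (fun y hy => (hK₂ y hy).trans ((le_max_right _ _).trans (le_max_left _ _))) le_rfl
    (by positivity) ((min_le_right _ _).trans (min_le_left _ _))
    ((min_le_right _ _).trans (min_le_right _ _)) hC
    (fun z hz => hT x z (mem_ball_self hρ) ?_)⟩
  simpa using hz.trans_le (min_le_left _ _)

/-- The left-hand side of the equation, written with a single integral. -/
noncomputable def jumpExpr (lam : ℝ) (ν : Space N → Measure (Space N))
    (H : Space N → Space N → ℝ) (u φ : Space N → ℝ) (a : ℝ) (x : Space N) (δ : ℝ) : ℝ :=
  lam * a - ∫ z, jump u φ a x (gradient φ x) δ z ∂(ν x) + H x (gradient φ x)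

/-- The merged integrand is dominated by the Lévy weight, so the two Bochner integrals are genuine,
not the default value 0, and add up to a single one. -/
lemma viscExpr_eq_jumpExpr (lam : ℝ) {ν : Space N → Measure (Space N)}
    (hν : ∀ ξ, IsLevyMeasure (ν ξ)) (H : Space N → Space N → ℝ) {u φ : Space N → ℝ}
    {x : Space N} {δ : ℝ} (hδ : 0 < δ) (hu : Measurable u) (huK : IsBddFun u)
    (hφ : ContDiffOn ℝ 2 φ (ball x δ)) (hφK : ∃ K, ∀ y ∈ ball x δ, |φ y| ≤ K) :
    viscExpr lam ν H u φ x δ = jumpExpr lam ν H u φ (u x) x δ := by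
  obtain ⟨C, hC⟩ := exists_levyBounded_jump (u x) hδ hu huK hφ hφK
  have h1 : levyOp ν x (ball 0 δ) x (gradient φ x) φ =
      ∫ z in ball 0 δ, jump u φ (u x) x (gradient φ x) δ z ∂(ν x) := by
    refine setIntegral_congr_fun measurableSet_ball fun z hz => ?_
    rw [mem_ball_zero_iff] at hz
    simp only [jump, if_pos hz]
  have h2 : levyOp ν x (ball 0 δ)ᶜ x (gradient φ x) u =
      ∫ z in (ball 0 δ)ᶜ, jump u φ (u x) x (gradient φ x) δ z ∂(ν x) := by
    refine setIntegral_congr_fun measurableSet_ball.compl fun z hz => ?_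
    rw [Set.mem_compl_iff, mem_ball_zero_iff] at hz
    simp only [jump, if_neg hz]
  rw [viscExpr, h1, h2, jumpExpr, ← integral_add_compl measurableSet_ball (hC.integrable (hν x))]
  ring

/-- Test functions must be bounded on all of `ℝ^N`, but the equation sees them only on the ball.
Cutting off by zero therefore admits test functions such as paraboloids. -/
lemma trunc_props {φ : Space N → ℝ} {x : Space N} {δ : ℝ} (hδ : 0 < δ)
    (hφ : ContDiffOn ℝ 2 φ (ball x δ)) (hφK : ∃ K, ∀ y ∈ ball x δ, |φ y| ≤ K) :
    ContDiffOn ℝ 2 ((ball x δ).indicator φ) (ball x δ) ∧ IsBddFun ((ball x δ).indicator φ) ∧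
      gradient ((ball x δ).indicator φ) x = gradient φ x := by
  refine ⟨hφ.congr fun y hy => Set.indicator_of_mem hy _, ?_, ?_⟩
  · obtain ⟨K, hK⟩ := hφK
    refine ⟨|K|, fun y => ?_⟩
    by_cases hy : y ∈ ball x δ
    · rw [Set.indicator_of_mem hy]
      exact (hK y hy).trans (le_abs_self K)
    · rw [Set.indicator_of_notMem hy]
      simp
  · refine EventuallyEq.gradient_eq ?_
    filter_upwards [ball_mem_nhds x hδ] with y hy using Set.indicator_of_mem hy _

lemma jumpExpr_trunc (lam : ℝ) (ν : Space N → Measure (Space N)) (H : Space N → Space N → ℝ)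
    (u : Space N → ℝ) {φ : Space N → ℝ} (a : ℝ) {x : Space N} {δ : ℝ} (hδ : 0 < δ)
    (hφ : ContDiffOn ℝ 2 φ (ball x δ)) (hφK : ∃ K, ∀ y ∈ ball x δ, |φ y| ≤ K) :
    jumpExpr lam ν H u ((ball x δ).indicator φ) a x δ = jumpExpr lam ν H u φ a x δ := by
  have h : ∀ p z, jump u ((ball x δ).indicator φ) a x p δ z = jump u φ a x p δ z := by
    intro p z
    unfold jump
    split_ifs with hz
    · rw [Set.indicator_of_mem (show x + z ∈ ball x δ by simpa using hz),
        Set.indicator_of_mem (mem_ball_self hδ)]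
    · rfl
  simp only [jumpExpr, h, (trunc_props hδ hφ hφK).2.2]

lemma IsViscositySubsolution.jumpExpr_le {lam : ℝ} {ν : Space N → Measure (Space N)}
    (hν : ∀ ξ, IsLevyMeasure (ν ξ)) {H : Space N → Space N → ℝ} {u : Space N → ℝ}
    (hu : IsViscositySubsolution lam ν H u) {φ : Space N → ℝ} {x : Space N} {δ : ℝ} (hδ : 0 < δ)
    (hφ : ContDiffOn ℝ 2 φ (ball x δ)) (hφK : ∃ K, ∀ y ∈ ball x δ, |φ y| ≤ K)
    (hmax : ∀ y ∈ ball x δ, u y - φ y ≤ u x - φ x) :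
    jumpExpr lam ν H u φ (u x) x δ ≤ 0 := by
  obtain ⟨h1, h2, h3⟩ := trunc_props hδ hφ hφK
  have := hu.2.2 _ x δ hδ h1 h2 (fun y hy => by
    rw [Set.indicator_of_mem hy, Set.indicator_of_mem (mem_ball_self hδ)]
    exact hmax y hy)
  rw [viscExpr_eq_jumpExpr lam hν H hδ hu.1.measurable hu.2.1 h1
    (h2.imp fun _ h y _ => h y)] at this
  rwa [jumpExpr_trunc lam ν H u _ hδ hφ hφK] at this

lemma IsViscositySupersolution.jumpExpr_nonneg {lam : ℝ} {ν : Space N → Measure (Space N)}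
    (hν : ∀ ξ, IsLevyMeasure (ν ξ)) {H : Space N → Space N → ℝ} {u : Space N → ℝ}
    (hu : IsViscositySupersolution lam ν H u) {φ : Space N → ℝ} {x : Space N} {δ : ℝ} (hδ : 0 < δ)
    (hφ : ContDiffOn ℝ 2 φ (ball x δ)) (hφK : ∃ K, ∀ y ∈ ball x δ, |φ y| ≤ K)
    (hmin : ∀ y ∈ ball x δ, u x - φ x ≤ u y - φ y) :
    0 ≤ jumpExpr lam ν H u φ (u x) x δ := by
  obtain ⟨h1, h2, h3⟩ := trunc_props hδ hφ hφK
  have := hu.2.2 _ x δ hδ h1 h2 (fun y hy => by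
    rw [Set.indicator_of_mem hy, Set.indicator_of_mem (mem_ball_self hδ)]
    exact hmin y hy)
  rw [viscExpr_eq_jumpExpr lam hν H hδ hu.1.measurable hu.2.1 h1
    (h2.imp fun _ h y _ => h y)] at this
  rwa [jumpExpr_trunc lam ν H u _ hδ hφ hφK] at this

/-- Comparison of the expressions of two functions at a point where the gradients of the test
functions agree. -/
lemma jumpExpr_mono {lam : ℝ} {ν : Space N → Measure (Space N)} {H : Space N → Space N → ℝ}
    {u₁ u₂ φ₁ φ₂ : Space N → ℝ} {a : ℝ} {x : Space N} {δ₁ δ₂ : ℝ}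
    (hg : gradient φ₁ x = gradient φ₂ x)
    (h₁ : Integrable (jump u₁ φ₁ a x (gradient φ₁ x) δ₁) (ν x))
    (h₂ : Integrable (jump u₂ φ₂ a x (gradient φ₂ x) δ₂) (ν x))
    (h : ∀ z, (if ‖z‖ < δ₁ then φ₁ (x + z) - φ₁ x else u₁ (x + z) - a) ≤
      (if ‖z‖ < δ₂ then φ₂ (x + z) - φ₂ x else u₂ (x + z) - a)) :
    jumpExpr lam ν H u₂ φ₂ a x δ₂ ≤ jumpExpr lam ν H u₁ φ₁ a x δ₁ := by
  unfold jumpExpr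
  rw [hg] at h₁ ⊢
  have := integral_mono h₁ h₂ fun z => by
    unfold jump
    exact sub_le_sub_right (h z) _
  linarith

/-- Adding a small paraboloid to the test function changes the expression only slightly. -/
lemma abs_jumpExpr_add_sq_sub_le (lam : ℝ) {ν : Space N → Measure (Space N)}
    (hν : ∀ ξ, IsLevyMeasure (ν ξ)) (H : Space N → Space N → ℝ) {u φ : Space N → ℝ} {a : ℝ}
    {x : Space N} {δ : ℝ} (hδ : 0 < δ) (hδ1 : δ ≤ 1) (hu : Measurable u) (huK : IsBddFun u)
    (hφ : ContDiffOn ℝ 2 φ (ball x δ)) (hφK : ∃ K, ∀ y ∈ ball x δ, |φ y| ≤ K) (η : ℝ) :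
    |jumpExpr lam ν H u (fun y => φ y + η * ‖y - x‖ ^ 2) a x δ - jumpExpr lam ν H u φ a x δ| ≤
      |η| * ∫ z, levyWeight z ∂(ν x) := by
  have hd : DifferentiableAt ℝ φ x :=
    (hφ.contDiffAt (ball_mem_nhds x hδ)).differentiableAt (by simp)
  have hg : gradient (fun y => φ y + η * ‖y - x‖ ^ 2) x = gradient φ x := by
    rw [(hasGradientAt_add hd.hasGradientAt (hasGradientAt_mul_norm_sub_sq x x η)).gradient]
    simp
  obtain ⟨C, hC⟩ := exists_levyBounded_jump a hδ hu huK hφ hφK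
  have hi := hC.integrable (hν x)
  have hb : LevyBounded |η| (fun z : Space N => if ‖z‖ < δ then η * ‖z‖ ^ 2 else 0) := by
    refine ⟨Measurable.ite (measurableSet_lt (by fun_prop) measurable_const) (by fun_prop)
      measurable_const, fun z => ?_⟩
    dsimp only
    split_ifs with hz
    · rw [levyWeight_of_norm_le_one (by linarith), abs_mul, abs_of_nonneg (sq_nonneg ‖z‖)]
    · simpa using mul_nonneg (abs_nonneg η) (levyWeight_nonneg z)
  have e : ∀ z, jump u (fun y => φ y + η * ‖y - x‖ ^ 2) a x (gradient φ x) δ z =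
      jump u φ a x (gradient φ x) δ z + if ‖z‖ < δ then η * ‖z‖ ^ 2 else 0 := by
    intro z
    unfold jump
    split_ifs
    · simp; ring
    · simp
  have hle : |∫ z, (if ‖z‖ < δ then η * ‖z‖ ^ 2 else 0) ∂(ν x)| ≤
      |η| * ∫ z, levyWeight z ∂(ν x) := by
    simpa using abs_setIntegral_le_levyWeight (hν x) hb Set.univ
  rw [jumpExpr, jumpExpr, hg]
  simp only [e]
  rw [integral_add hi (hb.integrable (hν x)), ← abs_neg]
  convert hle using 2
  ring

/-! ### Consequences of the assumptions on the Hamiltonian -/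

lemma IsModulus.apply_zero {ω : ℝ≥0 → ℝ≥0} (h : IsModulus ω) : ω 0 = 0 :=
  tendsto_nhds_unique (tendsto_pure_nhds ω 0) (h.mono_left (pure_le_nhds 0))

/-- With equal base points the `ω₁` term of (H1) vanishes, and a short momentum step raises `H` by a
bounded amount. Finitely many steps of length at most `t` reach any `p` in the ball from 0, where
`H` is bounded. -/
lemma exists_hamiltonian_le {H : Space N → Space N → ℝ} {m : ℝ} (hm : 1 < m)
    (hH0 : AssumptionH0 H) (hH1 : AssumptionH1 H m) (ρ : ℝ) :
    ∃ C, ∀ x p, ‖p‖ ≤ ρ → H x p ≤ C := by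
  obtain ⟨C₀, hC₀⟩ := hH0.2
  obtain ⟨ω₁, ω₂, h1, h2, h⟩ := hH1
  obtain ⟨s, hs, hω⟩ := h2.exists_lt zero_lt_one
  set t := min s 1 / 2 with ht
  have ht0 : 0 < t := by positivity
  have hts : t < s := by have := min_le_left s 1; linarith
  have ht1 : t ≤ 1 := by have := min_le_right s 1; linarith
  have key : ∀ n : ℕ, ∃ C, ∀ x p, ‖p‖ ≤ n * t → H x p ≤ C := by
    intro n
    induction n with
    | zero =>
      refine ⟨C₀, fun x p hp => ?_⟩
      have : p = 0 := by simpa using hp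
      rw [this]
      exact (le_abs_self _).trans (hC₀ x)
    | succ n ih =>
      obtain ⟨C, hC⟩ := ih
      refine ⟨C + (1 + (n * t) ^ (m - 1)), fun x p hp => ?_⟩
      push_cast at hp
      have hn : (0:ℝ) < n + 1 := by positivity
      set q := ((n + 1 : ℝ)⁻¹) • p with hq
      have hqn : ‖q‖ ≤ t := by
        rw [hq, norm_smul, Real.norm_eq_abs, abs_of_pos (by positivity), inv_mul_le_iff₀ hn]
        exact hp
      have hp' : ‖p - q‖ ≤ n * t := by
        have : p - q = (n : ℝ) • q := by
          rw [hq, smul_smul]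
          nth_rewrite 1 [← one_smul ℝ p]
          rw [← sub_smul]
          congr 1
          field_simp
          ring
        rw [this, norm_smul, Real.norm_eq_abs, abs_of_nonneg (by positivity)]
        gcongr
      have h3 := h x x (p - q) q (hqn.trans ht1)
      rw [sub_add_cancel, sub_self, nnnorm_zero, h1.apply_zero, NNReal.coe_zero, zero_mul,
        zero_add] at h3
      have h4 := hω ‖q‖₊ (by simpa using hqn.trans_lt hts)
      have h5 : ‖p - q‖ ^ (m - 1) ≤ (n * t) ^ (m - 1) :=
        Real.rpow_le_rpow (norm_nonneg _) hp' (by linarith)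
      have h6 := hC x (p - q) hp'
      have h7 : 0 ≤ ‖p - q‖ ^ (m - 1) := by positivity
      have h8 : (ω₂ ‖q‖₊ : ℝ) * (1 + ‖p - q‖ ^ (m - 1)) ≤ 1 * (1 + (n * t) ^ (m - 1)) := by
        gcongr
      linarith
  obtain ⟨n, hn⟩ := exists_nat_ge (ρ / t)
  obtain ⟨C, hC⟩ := key n
  exact ⟨C, fun x p hp => hC x p (hp.trans ((div_le_iff₀ ht0).1 hn))⟩

/-- The superlinear gain of the rescaled Hamiltonian. -/
lemma exists_hamiltonian_gain {H : Space N → Space N → ℝ} {m : ℝ} (hm : 1 < m)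
    (hH0 : AssumptionH0 H) (hH1 : AssumptionH1 H m) (hH2 : AssumptionH2 H m) :
    ∃ b > 0, ∀ η > 0, ∃ θ > 0, θ < 1 ∧ ∀ μ, 1 - θ ≤ μ → μ < 1 → ∀ x p,
      H x p - μ * H x (μ⁻¹ • p) ≤ η - (1 - μ) * b * ‖p‖ ^ m := by
  obtain ⟨b, b₀, r₀, μ₀, hb, hb0, hr0, hμ0, hμ1, hgain⟩ := hH2
  obtain ⟨C, hC⟩ := exists_hamiltonian_le hm hH0 hH1 (2 * r₀)
  obtain ⟨ω₁, ω₂, h1, h2, h⟩ := hH1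
  refine ⟨b, hb, fun η hη => ?_⟩
  set c := 1 + (2 * r₀) ^ (m - 1) with hc
  have hc0 : 0 < c := by positivity
  obtain ⟨s, hs, hω⟩ := h2.exists_lt (show 0 < η / (2 * c) by positivity)
  set D := |C| + b * r₀ ^ m + b₀ with hD
  have hD0 : 0 < D := by positivity
  -- The entries ensure in turn: `μ ≥ μ₀`, so that (H2) applies; `μ⁻¹ ≤ 2`; the shift `p - μ⁻¹ p` is
  -- shorter than `min s 1` when `|p| < r₀`; and `(1 - μ) D ≤ η/2`.
  set θ := min (min (1 - μ₀) (1 / 2)) (min (min s 1 / (4 * r₀)) (η / (2 * D))) with hθ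
  have hμ0' : 0 < 1 - μ₀ := by linarith
  have hθ0 : 0 < θ := by positivity
  have e1 : θ ≤ 1 - μ₀ := (min_le_left _ _).trans (min_le_left _ _)
  have e2 : θ ≤ 1 / 2 := (min_le_left _ _).trans (min_le_right _ _)
  have e3 : θ * (4 * r₀) ≤ min s 1 :=
    (le_div_iff₀ (by positivity)).1 ((min_le_right _ _).trans (min_le_left _ _))
  have e4 : θ * (2 * D) ≤ η :=
    (le_div_iff₀ (by positivity)).1 ((min_le_right _ _).trans (min_le_right _ _))
  refine ⟨θ, hθ0, by linarith, fun μ hμθ hμ x p => ?_⟩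
  have hμpos : 0 < μ := by linarith
  by_cases hp : r₀ ≤ ‖p‖
  · have := hgain μ (by linarith) hμ.le x p hp
    have h3 : (1 - μ) * b₀ ≤ η := by
      have : b₀ ≤ D := by rw [hD]; have := abs_nonneg C; have : 0 ≤ b * r₀ ^ m := by positivity
                          linarith
      nlinarith
    nlinarith
  -- For small momenta (H2) is silent. Write the left side as `(H(x,p) - H(x,μ⁻¹p)) + (1-μ)
  -- H(x,μ⁻¹p)`: the first bracket is small by (H1), the rest and the subtracted power are `O(1 -
  -- μ)`.
  · rw [not_le] at hp
    have hinv : μ⁻¹ ≤ 2 := by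
      rw [inv_le_comm₀ hμpos (by norm_num)]; linarith
    have hnp : ‖μ⁻¹ • p‖ ≤ 2 * r₀ := by
      rw [norm_smul, Real.norm_eq_abs, abs_of_pos (by positivity)]
      gcongr
    set q := p - μ⁻¹ • p with hq
    have hqe : q = (-((1 - μ) * μ⁻¹)) • p := by
      rw [hq]
      nth_rewrite 1 [← one_smul ℝ p]
      rw [← sub_smul]
      congr 1
      field_simp
      ring
    have hqn : ‖q‖ ≤ θ * 2 * r₀ := by
      rw [hqe, norm_smul, Real.norm_eq_abs, abs_neg, abs_of_nonneg
        (mul_nonneg (by linarith) (by positivity))]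
      gcongr
      linarith
    have hqs : ‖q‖ < min s 1 := by
      have : 0 < min s 1 := by positivity
      linarith
    have h3 := h x x (μ⁻¹ • p) q (hqs.le.trans (min_le_right _ _))
    rw [hq, add_sub_cancel, ← hq, sub_self, nnnorm_zero, h1.apply_zero, NNReal.coe_zero, zero_mul,
      zero_add] at h3
    have h4 := hω ‖q‖₊ (by simpa using hqs.trans_le (min_le_left _ _))
    have h5 : ‖μ⁻¹ • p‖ ^ (m - 1) ≤ (2 * r₀) ^ (m - 1) :=
      Real.rpow_le_rpow (norm_nonneg _) hnp (by linarith)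
    have h6 : (ω₂ ‖q‖₊ : ℝ) * (1 + ‖μ⁻¹ • p‖ ^ (m - 1)) ≤ η / (2 * c) * c := by
      rw [hc]; gcongr
    have h7 : η / (2 * c) * c = η / 2 := by field_simp
    have h8 : H x (μ⁻¹ • p) ≤ |C| := (hC x _ hnp).trans (le_abs_self C)
    have h9 : ‖p‖ ^ m ≤ r₀ ^ m := Real.rpow_le_rpow (norm_nonneg _) hp.le (by linarith)
    have h10 : (1 - μ) * H x (μ⁻¹ • p) ≤ (1 - μ) * |C| :=
      mul_le_mul_of_nonneg_left h8 (by linarith)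
    have h11 : (1 - μ) * (b * ‖p‖ ^ m) ≤ (1 - μ) * (b * r₀ ^ m) :=
      mul_le_mul_of_nonneg_left (by gcongr) (by linarith)
    have h12 : (1 - μ) * (|C| + b * r₀ ^ m) ≤ η / 2 := by
      have : (1 - μ) * (|C| + b * r₀ ^ m) ≤ θ * D := by
        rw [hD]
        have : 0 ≤ |C| + b * r₀ ^ m := by positivity
        nlinarith
      linarith
    linarith

/-! ### The nonlocal terms of two points -/

/-- Three ranges of jumps: inside `B_r` the integrals are compared through `γ`; on `B_R \ B_r` the
difference is `∫(G₁ - G₂) dν₁` plus the integral of `G₂` against `ν₁ - ν₂`; outside `B_R` one-sided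
bounds and small mass suffice. The terms over `B_δ` leave room for the test functions and vanish as
`δ → 0`. -/
lemma integral_sub_integral_le {ν₁ ν₂ : Measure (Space N)} (h₁ : IsLevyMeasure ν₁)
    (h₂ : IsLevyMeasure ν₂) {G₁ G₂ : Space N → ℝ} {C₁ C₂ : ℝ} (hG₁ : LevyBounded C₁ G₁)
    (hG₂ : LevyBounded C₂ G₂) {γ : Measure (Space N × Space N)}
    {δ r R α w c₁ c₂ K₂ K₃ τ τ' Cν : ℝ} (hr : 0 < r) (hr1 : r < 1) (hR : 1 < R)
    (hα : 0 ≤ α) (hK₂ : 0 ≤ K₂) (hK₃ : 0 ≤ K₃) (hτ : 0 ≤ τ) (hc₁ : 0 ≤ c₁) (hc₂ : 0 ≤ c₂)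
    (hγ : γ ∈ Admissible (ball (0 : Space N) r) (ν₁.restrict (ball 0 r)) (ν₂.restrict (ball 0 r)))
    (hγi : Integrable (fun z : Space N × Space N => ‖z.1 - z.2‖ ^ 2) γ)
    (hγw : ∫ z, ‖z.1 - z.2‖ ^ 2 ∂γ ≤ w)
    (hTV : totalVar ν₁ ν₂ (ball 0 R \ ball 0 r) ≤ ENNReal.ofReal τ)
    (hτ₁ : ν₁.real (ball 0 R)ᶜ ≤ τ') (hτ₂ : ν₂.real (ball 0 R)ᶜ ≤ τ')
    (hCν : ∫ z, levyWeight z ∂ν₁ ≤ Cν)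
    (hin : ∀ z₁ z₂, ‖z₁‖ < r → ‖z₂‖ < r → G₁ z₁ - G₂ z₂ ≤ 2 * α * ‖z₁ - z₂‖ ^ 2 +
      3 * α * (ball 0 δ).indicator levyWeight z₁ + 3 * α * (ball 0 δ).indicator levyWeight z₂ +
      c₁ * levyWeight z₁)
    (hmid : ∀ z ∈ ball (0 : Space N) R \ ball 0 r, G₁ z - G₂ z ≤ c₂)
    (hmid' : ∀ z ∈ ball (0 : Space N) R \ ball 0 r, |G₂ z| ≤ K₂)
    (hout₁ : ∀ z ∈ (ball (0 : Space N) R)ᶜ, G₁ z ≤ K₃)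
    (hout₂ : ∀ z ∈ (ball (0 : Space N) R)ᶜ, -G₂ z ≤ K₃) :
    ∫ z, G₁ z ∂ν₁ - ∫ z, G₂ z ∂ν₂ ≤ 2 * α * w + 3 * α * ∫ z in ball 0 δ, levyWeight z ∂ν₁ +
      3 * α * ∫ z in ball 0 δ, levyWeight z ∂ν₂ + c₁ * Cν + c₂ * (Cν / r ^ 2) + 2 * K₂ * τ +
      2 * K₃ * τ' := by
  have hrR : r < R := hr1.trans hR
  set A : Set (Space N) := ball 0 R \ ball 0 r with hA
  have hAm : MeasurableSet A := measurableSet_ball.diff measurableSet_ball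
  have hAsub : A ⊆ (ball 0 r)ᶜ := fun z hz => hz.2
  have hA₁ : ν₁ A < ∞ := (measure_mono hAsub).trans_lt (h₁.measure_compl_ball_lt_top hr)
  have hA₂ : ν₂ A < ∞ := (measure_mono hAsub).trans_lt (h₂.measure_compl_ball_lt_top hr)
  have i₁ := hG₁.integrable h₁
  have i₂ := hG₂.integrable h₂
  have i₂₁ := hG₂.integrable h₁
  -- small jumps
  have small : ∫ z in ball 0 r, G₁ z ∂ν₁ - ∫ z in ball 0 r, G₂ z ∂ν₂ ≤
      2 * α * w + 3 * α * ∫ z in ball 0 δ, levyWeight z ∂ν₁ +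
      3 * α * ∫ z in ball 0 δ, levyWeight z ∂ν₂ + c₁ * Cν := by
    set k : Space N → ℝ := (ball 0 δ).indicator levyWeight with hk
    have hkm : Measurable k := continuous_levyWeight.measurable.indicator measurableSet_ball
    have hw0 : levyWeight (0 : Space N) = 0 := by simp [levyWeight]
    have hk0 : k 0 = 0 := by simp [hk, Set.indicator, hw0]
    have hki : ∀ ν : Measure (Space N), IsLevyMeasure ν → Integrable k ν := fun ν h =>
      h.integrable_levyWeight.indicator measurableSet_ball
    have hkle : ∀ ν : Measure (Space N), IsLevyMeasure ν →
        ∫ z in ball 0 r, k z ∂ν ≤ ∫ z in ball 0 δ, levyWeight z ∂ν := fun ν h => by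
      rw [← integral_indicator (measurableSet_ball (x := (0 : Space N)) (ε := δ))]
      exact setIntegral_le_integral (hki ν h) (Eventually.of_forall fun z =>
        Set.indicator_nonneg (fun z _ => levyWeight_nonneg z) z)
    obtain ⟨a1, b1⟩ := Admissible.integrable_fst measurableSet_ball hγ hG₁.1 hG₁.apply_zero
      i₁.integrableOn
    obtain ⟨a2, b2⟩ := Admissible.integrable_snd measurableSet_ball hγ hG₂.1 hG₂.apply_zero
      i₂.integrableOn
    obtain ⟨a3, b3⟩ := Admissible.integrable_fst measurableSet_ball hγ hkm hk0
      (hki ν₁ h₁).integrableOn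
    obtain ⟨a4, b4⟩ := Admissible.integrable_snd measurableSet_ball hγ hkm hk0
      (hki ν₂ h₂).integrableOn
    obtain ⟨a5, b5⟩ := Admissible.integrable_fst measurableSet_ball hγ
      continuous_levyWeight.measurable hw0 h₁.integrable_levyWeight.integrableOn
    have A1 : Integrable (fun z : Space N × Space N =>
        2 * α * ‖z.1 - z.2‖ ^ 2 + 3 * α * k z.1) γ := (hγi.const_mul _).add (a3.const_mul _)
    have A2 : Integrable (fun z : Space N × Space N =>
        2 * α * ‖z.1 - z.2‖ ^ 2 + 3 * α * k z.1 + 3 * α * k z.2) γ := A1.add (a4.const_mul _)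
    have A3 : Integrable (fun z : Space N × Space N =>
        2 * α * ‖z.1 - z.2‖ ^ 2 + 3 * α * k z.1 + 3 * α * k z.2 + c₁ * levyWeight z.1) γ :=
      A2.add (a5.const_mul _)
    have hmono : ∫ z, (G₁ z.1 - G₂ z.2) ∂γ ≤ ∫ z, (2 * α * ‖z.1 - z.2‖ ^ 2 + 3 * α * k z.1 +
        3 * α * k z.2 + c₁ * levyWeight z.1) ∂γ := by
      refine integral_mono_ae (a1.sub a2) A3 ?_
      filter_upwards [Admissible.ae_mem hγ] with z hz
      exact hin z.1 z.2 (by simpa using hz.1) (by simpa using hz.2)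
    rw [integral_sub a1 a2, integral_add A2 (a5.const_mul _), integral_add A1 (a4.const_mul _),
      integral_add (hγi.const_mul _) (a3.const_mul _), integral_const_mul, integral_const_mul,
      integral_const_mul, integral_const_mul, b1, b2, b3, b4, b5] at hmono
    have j1 : 2 * α * ∫ z, ‖z.1 - z.2‖ ^ 2 ∂γ ≤ 2 * α * w := by gcongr
    have j2 := mul_le_mul_of_nonneg_left (hkle ν₁ h₁) (show 0 ≤ 3 * α by positivity)
    have j3 := mul_le_mul_of_nonneg_left (hkle ν₂ h₂) (show 0 ≤ 3 * α by positivity)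
    have j4 : ∫ z in ball 0 r, levyWeight z ∂ν₁ ≤ Cν := (setIntegral_le_integral
      h₁.integrable_levyWeight (Eventually.of_forall levyWeight_nonneg)).trans hCν
    have j5 := mul_le_mul_of_nonneg_left j4 hc₁
    linarith
  have mid : ∫ z in A, G₁ z ∂ν₁ - ∫ z in A, G₂ z ∂ν₂ ≤ c₂ * (Cν / r ^ 2) + 2 * K₂ * τ := by
    have k1 := setIntegral_sub_le_totalVar ν₁ ν₂ hAm hA₁ hA₂ hG₂.1 hK₂ hτ hmid' hTV
    have k2 : ∫ z in A, G₁ z ∂ν₁ - ∫ z in A, G₂ z ∂ν₁ ≤ c₂ * ν₁.real A := by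
      rw [← integral_sub i₁.integrableOn i₂₁.integrableOn]
      have := setIntegral_mono_on (μ := ν₁) (i₁.sub i₂₁).integrableOn
        (integrableOn_const (C := c₂) hA₁.ne) hAm hmid
      rw [setIntegral_const, smul_eq_mul, mul_comm] at this
      exact this
    have k3 := mul_le_mul_of_nonneg_left (h₁.measureReal_le hr hr1.le hCν hAsub) hc₂
    linarith
  have out : ∀ (ν : Measure (Space N)) (G : Space N → ℝ), IsLevyMeasure ν → Integrable G ν →
      ν.real (ball 0 R)ᶜ ≤ τ' → (∀ z ∈ (ball (0 : Space N) R)ᶜ, G z ≤ K₃) →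
      ∫ z in (ball 0 R)ᶜ, G z ∂ν ≤ K₃ * τ' := by
    intro ν G h hG hτ hK
    have := setIntegral_mono_on (μ := ν) hG.integrableOn
      (integrableOn_const (C := K₃) (h.measure_compl_ball_lt_top (by linarith)).ne)
      measurableSet_ball.compl hK
    rw [setIntegral_const, smul_eq_mul, mul_comm] at this
    exact this.trans (mul_le_mul_of_nonneg_left hτ hK₃)
  have o1 := out ν₁ G₁ h₁ i₁ hτ₁ hout₁
  have o2 := out ν₂ (fun z => -G₂ z) h₂ i₂.neg hτ₂ hout₂
  rw [integral_neg] at o2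
  rw [integral_split i₁ hrR.le, integral_split i₂ hrR.le]
  linarith

/-! ### The localizing function -/

/-- A bounded smooth function, small on compact sets for small `b`, and close to `L` at infinity. -/
noncomputable def localizer (L b : ℝ) (x : Space N) : ℝ := L * (1 - (1 + b ^ 2 * ‖x‖ ^ 2)⁻¹)

/-- The gradient of `localizer`. -/
noncomputable def localizerGrad (L b : ℝ) (x : Space N) : Space N :=
  (2 * L * b ^ 2 / (1 + b ^ 2 * ‖x‖ ^ 2) ^ 2) • x

lemma contDiff_localizer (L b : ℝ) : ContDiff ℝ 2 (localizer (N := N) L b) := by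
  unfold localizer
  refine contDiff_const.mul (contDiff_const.sub (ContDiff.inv ?_ fun x => by positivity))
  exact contDiff_const.add (contDiff_const.mul (contDiff_norm_sq ℝ))

lemma hasGradientAt_localizer (L b : ℝ) (x : Space N) :
    HasGradientAt (localizer L b) (localizerGrad L b x) x := by
  have hpos : (1 + b ^ 2 * ‖x‖ ^ 2) ≠ 0 := by positivity
  have h1 := (hasFDerivAt_id x).norm_sq.const_mul (b ^ 2) |>.const_add 1
  have h2 := (hasDerivAt_inv hpos).comp_hasFDerivAt x h1
  have h3 := (h2.const_sub 1).const_mul L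
  rw [hasGradientAt_iff_hasFDerivAt]
  refine h3.congr_fderiv ?_
  ext v
  simp [localizerGrad]
  ring

lemma norm_localizerGrad_le {L b : ℝ} (hL : 0 ≤ L) (hb : 0 ≤ b) (x : Space N) :
    ‖localizerGrad L b x‖ ≤ L * b := by
  rw [localizerGrad, norm_smul, Real.norm_eq_abs, abs_of_nonneg (by positivity),
    div_mul_eq_mul_div, div_le_iff₀ (by positivity)]
  have h1 : 2 * (b * ‖x‖) ≤ (1 + b ^ 2 * ‖x‖ ^ 2) ^ 2 := by
    have : 0 ≤ (b * ‖x‖) ^ 2 := by positivity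
    nlinarith [sq_nonneg (b * ‖x‖ - 1)]
  nlinarith [mul_le_mul_of_nonneg_left h1 (show 0 ≤ L * b by positivity)]

/-- The localizer is a concave function of `|x|²`, so it lies below its tangent in that variable,
and `|x + z|²` is explicitly quadratic in `z`. The bound holds for all `z`, large jumps included. -/
lemma localizer_add_sub_le {L b : ℝ} (hL : 0 ≤ L) (x z : Space N) :
    localizer L b (x + z) - localizer L b x - inner ℝ (localizerGrad L b x) z ≤
      L * b ^ 2 * ‖z‖ ^ 2 := by
  have hn : ‖x + z‖ ^ 2 = ‖x‖ ^ 2 + 2 * inner ℝ x z + ‖z‖ ^ 2 := norm_add_sq_real x z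
  set s := 1 + b ^ 2 * ‖x‖ ^ 2 with hs
  set t := 1 + b ^ 2 * ‖x + z‖ ^ 2 with ht
  have hs1 : 1 ≤ s := by rw [hs]; have : 0 ≤ b ^ 2 * ‖x‖ ^ 2 := by positivity
                         linarith
  have ht1 : 1 ≤ t := by rw [ht]; have : 0 ≤ b ^ 2 * ‖x + z‖ ^ 2 := by positivity
                         linarith
  have hts : t - s = b ^ 2 * (2 * inner ℝ x z + ‖z‖ ^ 2) := by rw [ht, hs, hn]; ring
  have h1 : s⁻¹ - t⁻¹ ≤ (t - s) / s ^ 2 := by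
    rw [inv_sub_inv (by positivity) (by positivity), div_le_div_iff₀ (by positivity)
      (by positivity)]
    nlinarith [mul_nonneg (show 0 ≤ s by linarith) (sq_nonneg (t - s))]
  have h2 : inner ℝ (localizerGrad L b x) z = 2 * L * b ^ 2 / s ^ 2 * inner ℝ x z := by
    rw [localizerGrad, real_inner_smul_left]
  have h3 : localizer L b (x + z) - localizer L b x = L * (s⁻¹ - t⁻¹) := by
    unfold localizer; ring
  have h4 : L * (s⁻¹ - t⁻¹) ≤ L * ((t - s) / s ^ 2) := by gcongr
  have h5 : L * ((t - s) / s ^ 2) =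
      2 * L * b ^ 2 / s ^ 2 * inner ℝ x z + L * b ^ 2 * ‖z‖ ^ 2 / s ^ 2 := by
    rw [hts]; ring
  have h6 : L * b ^ 2 * ‖z‖ ^ 2 / s ^ 2 ≤ L * b ^ 2 * ‖z‖ ^ 2 :=
    div_le_self (by positivity) (by nlinarith)
  rw [h3, h2]
  linarith

lemma localizer_nonneg {L b : ℝ} (hL : 0 ≤ L) (x : Space N) : 0 ≤ localizer L b x := by
  refine mul_nonneg hL (sub_nonneg.2 (inv_le_one_of_one_le₀ ?_))
  have : 0 ≤ b ^ 2 * ‖x‖ ^ 2 := by positivity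
  linarith

lemma localizer_le {L b : ℝ} (hL : 0 ≤ L) (x : Space N) :
    localizer L b x ≤ L * b ^ 2 * ‖x‖ ^ 2 := by
  have h : 0 ≤ b ^ 2 * ‖x‖ ^ 2 := by positivity
  have : 1 - (1 + b ^ 2 * ‖x‖ ^ 2)⁻¹ ≤ b ^ 2 * ‖x‖ ^ 2 := by
    rw [sub_le_comm, ← one_div, le_div_iff₀ (by positivity)]
    nlinarith
  unfold localizer
  nlinarith

/-! ### Comparison principle -/

/-- The factor `8K` confines the maximum: beyond `|x| = 1/b` the localizer exceeds `4K`, whereas a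
nonnegative value of the functional allows at most `2K`, and likewise `α|x - y|² ≤ 2K`. So the set
of nonnegative values is bounded, and it contains `(x₀, x₀)`. -/
lemma exists_doubling_max {u v : Space N → ℝ} (hu : UpperSemicontinuous u)
    (hv : LowerSemicontinuous v) {K α b μ : ℝ} (hK : 0 < K) (huK : ∀ x, |u x| ≤ K)
    (hvK : ∀ x, |v x| ≤ K) (hα : 0 < α) (hb : 0 < b) (hμ0 : 0 < μ) (hμ1 : μ ≤ 1) {x₀ : Space N}
    (h0 : 0 ≤ μ * u x₀ - v x₀ - localizer (8 * K) b x₀) :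
    ∃ x y, ∀ x' y', μ * u x' - v y' - α * ‖x' - y'‖ ^ 2 - localizer (8 * K) b x' ≤
      μ * u x - v y - α * ‖x - y‖ ^ 2 - localizer (8 * K) b x := by
  set Φ : Space N × Space N → ℝ := fun w =>
    μ * u w.1 - v w.2 - α * ‖w.1 - w.2‖ ^ 2 - localizer (8 * K) b w.1 with hΦ
  set ρ := 1 / b + Real.sqrt (2 * K / α) + ‖x₀‖ with hρ
  have hsq := Real.sqrt_nonneg (2 * K / α)
  have hb' : 0 < 1 / b := by positivity
  have hx₀ := norm_nonneg x₀
  have hmem : ∀ w : Space N × Space N, 0 ≤ Φ w → w ∈ closedBall (0 : Space N) ρ ×ˢ closedBall 0 ρ := by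
    intro w hw
    have h1 := abs_le.1 (huK w.1)
    have h2 := abs_le.1 (hvK w.2)
    have h3 : 0 ≤ α * ‖w.1 - w.2‖ ^ 2 := by positivity
    have h4 := localizer_nonneg (b := b) (show 0 ≤ 8 * K by positivity) w.1
    have h5 : μ * u w.1 ≤ K := by nlinarith
    simp only [hΦ] at hw
    have h6 : localizer (8 * K) b w.1 ≤ 2 * K := by linarith
    have h7 : α * ‖w.1 - w.2‖ ^ 2 ≤ 2 * K := by linarith
    have h8 : ‖w.1‖ ≤ 1 / b := by
      rw [le_div_iff₀ hb]
      by_contra hcon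
      rw [not_le] at hcon
      have h9 : 1 < b ^ 2 * ‖w.1‖ ^ 2 := by nlinarith
      have h10 : (1 + b ^ 2 * ‖w.1‖ ^ 2)⁻¹ ≤ 1 / 2 := by
        rw [inv_le_comm₀ (by positivity) (by norm_num)]; linarith
      unfold localizer at h6
      nlinarith
    have h11 : ‖w.1 - w.2‖ ≤ Real.sqrt (2 * K / α) := by
      refine Real.le_sqrt_of_sq_le ?_
      rw [le_div_iff₀ hα]; linarith
    have h12 : ‖w.2‖ ≤ ‖w.1‖ + ‖w.1 - w.2‖ := by
      have := norm_sub_le w.1 (w.1 - w.2)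
      simpa using this
    refine ⟨?_, ?_⟩ <;> rw [mem_closedBall_zero_iff] <;> linarith
  have husc : UpperSemicontinuous Φ := by
    have e1 : UpperSemicontinuous fun w : Space N × Space N => μ * u w.1 := by
      intro w c hc
      have hc' : u w.1 < c / μ := by rw [lt_div_iff₀ hμ0, mul_comm]; exact hc
      have := hu w.1 (c / μ) hc'
      filter_upwards [continuous_fst.continuousAt.eventually this] with w' hw'
      rwa [lt_div_iff₀ hμ0, mul_comm] at hw'
    have e2 : UpperSemicontinuous fun w : Space N × Space N => -v w.2 := by
      intro w c hc
      have hc' : -c < v w.2 := by have : -v w.2 < c := hc; linarith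
      have := hv w.2 (-c) hc'
      filter_upwards [continuous_snd.continuousAt.eventually this] with w' hw'
      linarith
    have e3 : Continuous fun w : Space N × Space N =>
        -(α * ‖w.1 - w.2‖ ^ 2) - localizer (8 * K) b w.1 := by
      have := (contDiff_localizer (N := N) (8 * K) b).continuous
      fun_prop
    have := (e1.add e2).add e3.upperSemicontinuous
    refine (congrArg UpperSemicontinuous (funext fun w => ?_)).mp this
    simp only [hΦ]; ring
  have h0' : 0 ≤ Φ (x₀, x₀) := by simpa [hΦ] using h0
  obtain ⟨w, hw, hmax⟩ := UpperSemicontinuousOn.exists_isMaxOn (f := Φ)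
    (s := closedBall (0 : Space N) ρ ×ˢ closedBall 0 ρ) ⟨_, hmem _ h0'⟩
    ((isCompact_closedBall _ _).prod (isCompact_closedBall _ _)) (husc.upperSemicontinuousOn _)
  refine ⟨w.1, w.2, fun x' y' => ?_⟩
  show Φ (x', y') ≤ Φ w
  by_cases hp : 0 ≤ Φ (x', y')
  · exact hmax (hmem _ hp)
  · exact (not_le.1 hp).le.trans (h0'.trans (hmax (hmem _ h0')))

lemma exists_bound_on_ball {φ : Space N → ℝ} (hφ : Continuous φ) (x : Space N) (δ : ℝ) :
    ∃ K, ∀ y ∈ ball x δ, |φ y| ≤ K := by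
  obtain ⟨K, hK⟩ := (isCompact_closedBall x δ).exists_bound_of_continuousOn hφ.continuousOn
  exact ⟨K, fun y hy => hK y (ball_subset_closedBall hy)⟩

/-- Test `u` with `μ⁻¹(α|·-y|² + ψ)` and `v` with `-α|·-x|²`, multiply the first inequality by `μ`
and subtract. Maximality at the shifted pair `(x + z₁, y + z₂)` bounds the difference of the
integrands; expanding the square, its linear terms cancel the compensators and leave `α|z₁ - z₂|²`.
-/
lemma doubling_estimate {lam : ℝ} {ν : Space N → Measure (Space N)}
    (hν : ∀ ξ, IsLevyMeasure (ν ξ)) {H : Space N → Space N → ℝ} {u v : Space N → ℝ}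
    (hu : IsViscositySubsolution lam ν H u) (hv : IsViscositySupersolution lam ν H v)
    {K L α b μ r R w τ τ' Cν : ℝ} (huK : ∀ x, |u x| ≤ K) (hvK : ∀ x, |v x| ≤ K) (hL : 0 ≤ L)
    (hα : 0 ≤ α) (hb : 0 ≤ b) (hμ0 : 0 < μ) (hμ1 : μ ≤ 1) (hr : 0 < r) (hr1 : r < 1) (hR : 1 < R)
    (hτ : 0 ≤ τ) {x y : Space N}
    (hmax : ∀ x' y', μ * u x' - v y' - α * ‖x' - y'‖ ^ 2 - localizer L b x' ≤
      μ * u x - v y - α * ‖x - y‖ ^ 2 - localizer L b x)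
    {γ : Measure (Space N × Space N)}
    (hγ : γ ∈ Admissible (ball (0 : Space N) r) ((ν x).restrict (ball 0 r))
      ((ν y).restrict (ball 0 r)))
    (hγi : Integrable (fun z : Space N × Space N => ‖z.1 - z.2‖ ^ 2) γ)
    (hγw : ∫ z, ‖z.1 - z.2‖ ^ 2 ∂γ ≤ w)
    (hTV : totalVar (ν x) (ν y) (ball 0 R \ ball 0 r) ≤ ENNReal.ofReal τ)
    (hτ' : ∀ ξ, (ν ξ).real (ball 0 R)ᶜ ≤ τ') (hCν : ∀ ξ, ∫ z, levyWeight z ∂(ν ξ) ≤ Cν) :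
    lam * (μ * u x - v y) ≤ 2 * α * w + L * b ^ 2 * Cν +
      (L * b ^ 2 * R ^ 2 + L * b * R) * (Cν / r ^ 2) +
      2 * (2 * K + ‖(2 * α) • (x - y)‖) * τ + 2 * (2 * K) * τ' +
      (H y ((2 * α) • (x - y)) - μ * H x (μ⁻¹ • ((2 * α) • (x - y) + localizerGrad L b x))) := by
  set p := (2 * α) • (x - y) with hp
  set q := localizerGrad L b x with hq
  set ψ : Space N → ℝ := localizer L b with hψ
  have hK : 0 ≤ K := (abs_nonneg _).trans (huK x)
  have hpi : ∀ z, inner ℝ p z = 2 * α * inner ℝ (x - y) z := fun z => by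
    rw [hp, real_inner_smul_left]
  set φ₁ : Space N → ℝ := fun x' => μ⁻¹ * (α * ‖x' - y‖ ^ 2 + ψ x') with hφ₁
  set φ₂ : Space N → ℝ := fun y' => (-α) * ‖y' - x‖ ^ 2 with hφ₂
  have hsqd : ∀ c : Space N, ContDiff ℝ 2 fun y : Space N => ‖y - c‖ ^ 2 := fun c =>
    (contDiff_norm_sq ℝ).comp (contDiff_id.sub contDiff_const)
  have hd₁ : ContDiff ℝ 2 φ₁ :=
    contDiff_const.mul ((contDiff_const.mul (hsqd y)).add (contDiff_localizer L b))
  have hd₂ : ContDiff ℝ 2 φ₂ := contDiff_const.mul (hsqd x)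
  have hg₁ : gradient φ₁ x = μ⁻¹ • (p + q) := (hasGradientAt_const_mul μ⁻¹ (hasGradientAt_add
    (hasGradientAt_mul_norm_sub_sq y x α) (hasGradientAt_localizer L b x))).gradient
  have hg₂ : gradient φ₂ y = p := by
    rw [(hasGradientAt_mul_norm_sub_sq x y (-α)).gradient, hp, ← neg_sub x y, smul_neg, ← neg_smul]
    congr 1; ring
  have hexp : ∀ z₁ z₂, α * ‖x + z₁ - (y + z₂)‖ ^ 2 = α * ‖x - y‖ ^ 2 + inner ℝ p z₁ -
      inner ℝ p z₂ + α * ‖z₁ - z₂‖ ^ 2 := by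
    intro z₁ z₂
    rw [show x + z₁ - (y + z₂) = (x - y) + (z₁ - z₂) by abel, norm_add_sq_real, hpi, hpi,
      inner_sub_right]
    ring
  have hψz : ∀ z, ψ (x + z) - ψ x - inner ℝ q z ≤ L * b ^ 2 * ‖z‖ ^ 2 := fun z =>
    localizer_add_sub_le hL x z
  have key : ∀ δ, 0 < δ → δ < r → lam * (μ * u x - v y) ≤
      (2 * α * w + 3 * α * ∫ z in ball 0 δ, levyWeight z ∂(ν x) +
      3 * α * ∫ z in ball 0 δ, levyWeight z ∂(ν y) + L * b ^ 2 * Cν +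
      (L * b ^ 2 * R ^ 2 + L * b * R) * (Cν / r ^ 2) +
      2 * (2 * K + ‖p‖) * τ + 2 * (2 * K) * τ') +
      (H y p - μ * H x (μ⁻¹ • (p + q))) := by
    intro δ hδ hδr
    have t₁ := hu.jumpExpr_le hν (φ := φ₁) (x := x) hδ hd₁.contDiffOn
      (exists_bound_on_ball hd₁.continuous x δ) (fun x' _ => by
        have h1 := hmax x' y
        have h2 : u x' - φ₁ x' = μ⁻¹ * (μ * u x' - α * ‖x' - y‖ ^ 2 - ψ x') := by
          simp only [hφ₁]; field_simp; ring
        have h3 : u x - φ₁ x = μ⁻¹ * (μ * u x - α * ‖x - y‖ ^ 2 - ψ x) := by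
          simp only [hφ₁]; field_simp; ring
        rw [h2, h3]
        exact mul_le_mul_of_nonneg_left (by linarith) (by positivity))
    have t₂ := hv.jumpExpr_nonneg hν (φ := φ₂) (x := y) hδ hd₂.contDiffOn
      (exists_bound_on_ball hd₂.continuous y δ) (fun y' _ => by
        have h1 := hmax x y'
        simp only [hφ₂]
        rw [norm_sub_rev y' x, norm_sub_rev y x]
        linarith)
    obtain ⟨C₁, hC₁⟩ := exists_levyBounded_jump (u x) (x := x) hδ hu.1.measurable hu.2.1
      hd₁.contDiffOn (exists_bound_on_ball hd₁.continuous x δ)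
    obtain ⟨C₂, hC₂⟩ := exists_levyBounded_jump (v y) (x := y) hδ hv.1.measurable hv.2.1
      hd₂.contDiffOn (exists_bound_on_ball hd₂.continuous y δ)
    rw [jumpExpr, hg₁] at t₁
    rw [jumpExpr, hg₂] at t₂
    rw [hg₁] at hC₁
    rw [hg₂] at hC₂
    set G₁ : Space N → ℝ := fun z => μ * jump u φ₁ (u x) x (μ⁻¹ • (p + q)) δ z with hG₁
    set G₂ : Space N → ℝ := jump v φ₂ (v y) y p δ with hG₂
    have hG₁b : LevyBounded (μ * C₁) G₁ := ⟨hC₁.1.const_mul μ, fun z => by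
      simp only [hG₁]
      rw [abs_mul, abs_of_pos hμ0, mul_assoc]
      gcongr
      exact hC₁.2 z⟩
    have e₁ : ∀ z, G₁ z = (if ‖z‖ < δ then α * ‖x + z - (y + 0)‖ ^ 2 - α * ‖x - y‖ ^ 2 +
        (ψ (x + z) - ψ x) else μ * (u (x + z) - u x)) -
        (ball (0 : Space N) 1).indicator (fun w => inner ℝ p w + inner ℝ q w) z := by
      intro z
      have hind : μ * (ball (0 : Space N) 1).indicator
          (fun w => inner ℝ (μ⁻¹ • (p + q)) w) z =
          (ball (0 : Space N) 1).indicator (fun w => inner ℝ p w + inner ℝ q w) z := by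
        by_cases hz : z ∈ ball (0 : Space N) 1
        · rw [Set.indicator_of_mem hz, Set.indicator_of_mem hz, real_inner_smul_left,
            inner_add_left, mul_inv_cancel_left₀ hμ0.ne']
        · rw [Set.indicator_of_notMem hz, Set.indicator_of_notMem hz, mul_zero]
      simp only [hG₁, jump]
      rw [mul_sub, hind]
      congr 1
      split_ifs
      · simp only [hφ₁, add_zero]; field_simp; ring
      · rfl
    have e₂ : ∀ z, G₂ z = (if ‖z‖ < δ then -(α * ‖x + 0 - (y + z)‖ ^ 2 - α * ‖x - y‖ ^ 2)
        else v (y + z) - v y) - (ball (0 : Space N) 1).indicator (fun w => inner ℝ p w) z := by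
      intro z
      simp only [hG₂, jump]
      congr 1
      split_ifs
      · simp only [hφ₂, add_zero]
        rw [norm_sub_rev (y + z) x, norm_sub_rev y x]; ring
      · rfl
    have i1 : ∀ z : Space N, ‖z‖ < 1 → z ∈ ball (0 : Space N) 1 := fun z hz => by simpa using hz
    have f₁ : ∀ z, ‖z‖ < 1 → G₁ z ≤ α * ‖z‖ ^ 2 + L * b ^ 2 * ‖z‖ ^ 2 := by
      intro z hz
      have h1 := hexp z 0
      have h2 := hmax (x + z) (y + 0)
      have h3 := hψz z
      rw [inner_zero_right, sub_zero z] at h1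
      rw [e₁, Set.indicator_of_mem (i1 z hz)]
      split_ifs
      · linarith
      · rw [add_zero] at h1 h2; linarith
    have f₂ : ∀ z, ‖z‖ < 1 → -G₂ z ≤ α * ‖z‖ ^ 2 := by
      intro z hz
      have h1 := hexp 0 z
      have h2 := hmax (x + 0) (y + z)
      rw [inner_zero_right, zero_sub, norm_neg] at h1
      rw [e₂, Set.indicator_of_mem (i1 z hz)]
      split_ifs
      · linarith
      · rw [add_zero] at h1 h2; linarith
    have f₃ : ∀ z₁ z₂, δ ≤ ‖z₁‖ → δ ≤ ‖z₂‖ → ‖z₁‖ < 1 → ‖z₂‖ < 1 →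
        G₁ z₁ - G₂ z₂ ≤ α * ‖z₁ - z₂‖ ^ 2 + L * b ^ 2 * ‖z₁‖ ^ 2 := by
      intro z₁ z₂ h1 h2 h3 h4
      have h5 := hexp z₁ z₂
      have h6 := hmax (x + z₁) (y + z₂)
      have h7 := hψz z₁
      rw [e₁, e₂, Set.indicator_of_mem (i1 _ h3), Set.indicator_of_mem (i1 _ h4),
        if_neg (not_lt.2 h1), if_neg (not_lt.2 h2)]
      linarith
    have hδ1 : δ < 1 := hδr.trans hr1
    have kpos : ∀ z : Space N, 0 ≤ (ball (0 : Space N) δ).indicator levyWeight z := fun z =>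
      Set.indicator_nonneg (fun z _ => levyWeight_nonneg z) z
    have kval : ∀ z : Space N, ‖z‖ < δ →
        (ball (0 : Space N) δ).indicator levyWeight z = ‖z‖ ^ 2 := fun z hz => by
      rw [Set.indicator_of_mem (by simpa using hz), levyWeight_of_norm_le_one (by linarith)]
    -- If one of the jumps lies in `B_δ`, the joint estimate `f₃` is unavailable and `f₁`, `f₂` give
    -- `α|z₁|² + α|z₂|²`. Replacing the other square by this inequality leaves `2α|z₁ - z₂|²` plus
    -- `3α` times the square of the jump in `B_δ`.
    have nsq : ∀ z₁ z₂ : Space N, ‖z₁‖ ^ 2 ≤ 2 * ‖z₁ - z₂‖ ^ 2 + 2 * ‖z₂‖ ^ 2 := by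
      intro z₁ z₂
      have h1 : ‖z₁‖ ≤ ‖z₁ - z₂‖ + ‖z₂‖ := by simpa using norm_add_le (z₁ - z₂) z₂
      nlinarith [norm_nonneg z₁, sq_nonneg (‖z₁ - z₂‖ - ‖z₂‖)]
    have hdiff := integral_sub_integral_le (hν x) (hν y) hG₁b hC₂ (δ := δ) (c₁ := L * b ^ 2)
      (c₂ := L * b ^ 2 * R ^ 2 + L * b * R) (K₂ := 2 * K + ‖p‖) (K₃ := 2 * K) hr hr1 hR hα
      (by positivity) (by positivity) hτ (by positivity) (by positivity) hγ hγi hγw hTV (hτ' x)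
      (hτ' y) (hCν x)
      (by
        intro z₁ z₂ h1 h2
        have h1' := h1.trans hr1
        have h2' := h2.trans hr1
        rw [levyWeight_of_norm_le_one h1'.le]
        have a1 := f₁ z₁ h1'
        have a2 := f₂ z₂ h2'
        have b1 := mul_nonneg hα (kpos z₁)
        have b2 := mul_nonneg hα (kpos z₂)
        have b3 : 0 ≤ α * ‖z₁ - z₂‖ ^ 2 := by positivity
        by_cases c1 : ‖z₁‖ < δ
        · rw [kval z₁ c1] at *
          have := mul_le_mul_of_nonneg_left (nsq z₂ z₁) hα
          rw [norm_sub_rev] at this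
          linarith
        · by_cases c2 : ‖z₂‖ < δ
          · rw [kval z₂ c2] at *
            have := mul_le_mul_of_nonneg_left (nsq z₁ z₂) hα
            linarith
          · have := f₃ z₁ z₂ (not_lt.1 c1) (not_lt.1 c2) h1' h2'
            linarith)
      (by
        intro z hz
        have hzR : ‖z‖ < R := by simpa using hz.1
        have hzr : r ≤ ‖z‖ := by simpa using hz.2
        -- Equal shifts do not change `x - y`, so only the localizer contributes. The compensator
        -- removes `⟨q, z⟩` inside the unit ball; outside it this term costs `L b R`.
        have h5 := hexp z z
        rw [sub_self, norm_zero] at h5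
        have h6 := hmax (x + z) (y + z)
        have h7 := hψz z
        have h8 : L * b ^ 2 * ‖z‖ ^ 2 ≤ L * b ^ 2 * R ^ 2 := by gcongr
        have h9 : inner ℝ q z ≤ L * b * R := (real_inner_le_norm q z).trans
          (mul_le_mul (norm_localizerGrad_le hL hb x) hzR.le (norm_nonneg _) (by positivity))
        have h10 : 0 ≤ L * b * R := by positivity
        have hnl : ¬ ‖z‖ < δ := not_lt.2 (hδr.le.trans hzr)
        show G₁ z - G₂ z ≤ _
        rw [e₁, e₂, if_neg hnl, if_neg hnl]
        by_cases hz1 : z ∈ ball (0 : Space N) 1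
        · rw [Set.indicator_of_mem hz1, Set.indicator_of_mem hz1]
          linarith
        · rw [Set.indicator_of_notMem hz1, Set.indicator_of_notMem hz1]
          linarith)
      (by
        intro z hz
        have hzr : r ≤ ‖z‖ := by simpa using hz.2
        show |G₂ z| ≤ _
        rw [e₂, if_neg (not_lt.2 (hδr.le.trans hzr))]
        have h1 := abs_sub (v (y + z) - v y)
          ((ball (0 : Space N) 1).indicator (fun w => inner ℝ p w) z)
        have h2 := abs_sub (v (y + z)) (v y)
        have h3 := abs_indicator_inner_le p z
        have h4 := hvK (y + z)
        have h5 := hvK y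
        linarith)
      (by
        intro z hz
        have hzR : R ≤ ‖z‖ := by simpa using hz
        have hz1 : z ∉ ball (0 : Space N) 1 := by simpa using hR.le.trans hzR
        rw [e₁, if_neg (not_lt.2 (by linarith)), Set.indicator_of_notMem hz1]
        have h4 := abs_le.1 (huK (x + z))
        have h5 := abs_le.1 (huK x)
        nlinarith)
      (by
        intro z hz
        have hzR : R ≤ ‖z‖ := by simpa using hz
        have hz1 : z ∉ ball (0 : Space N) 1 := by simpa using hR.le.trans hzR
        show -G₂ z ≤ _
        rw [e₂, if_neg (not_lt.2 (by linarith)), Set.indicator_of_notMem hz1]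
        have h4 := abs_le.1 (hvK (y + z))
        have h5 := abs_le.1 (hvK y)
        linarith)
    have hint : ∫ z, G₁ z ∂(ν x) = μ * ∫ z, jump u φ₁ (u x) x (μ⁻¹ • (p + q)) δ z ∂(ν x) :=
      integral_const_mul _ _
    rw [hint] at hdiff
    have t₁' := mul_le_mul_of_nonneg_left t₁ hμ0.le
    linarith
  -- Only the two integrals over `B_δ` depend on `δ`; the maximum point, the coupling and all other
  -- constants stay fixed.
  have hlim : Tendsto (fun δ : ℝ => (2 * α * w + 3 * α * ∫ z in ball 0 δ, levyWeight z ∂(ν x) +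
      3 * α * ∫ z in ball 0 δ, levyWeight z ∂(ν y) + L * b ^ 2 * Cν +
      (L * b ^ 2 * R ^ 2 + L * b * R) * (Cν / r ^ 2) +
      2 * (2 * K + ‖p‖) * τ + 2 * (2 * K) * τ') +
      (H y p - μ * H x (μ⁻¹ • (p + q)))) (𝓝[>] 0) (𝓝 ((2 * α * w + 3 * α * 0 +
      3 * α * 0 + L * b ^ 2 * Cν +
      (L * b ^ 2 * R ^ 2 + L * b * R) * (Cν / r ^ 2) +
      2 * (2 * K + ‖p‖) * τ + 2 * (2 * K) * τ') +
      (H y p - μ * H x (μ⁻¹ • (p + q))))) := by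
    refine Tendsto.add_const _ (Tendsto.add_const _ (Tendsto.add_const _ (Tendsto.add_const _
      (Tendsto.add_const _ (Tendsto.add (Tendsto.const_add _ ?_) ?_)))))
    · exact (hν x).tendsto_setIntegral_ball.const_mul _
    · exact (hν y).tendsto_setIntegral_ball.const_mul _
  have := ge_of_tendsto hlim (by
    filter_upwards [Ioo_mem_nhdsGT hr] with δ hδ using key δ hδ.1 hδ.2)
  linarith

lemma eventually_mul_lt (c : ℝ) {e : ℝ} (he : 0 < e) : ∀ᶠ b in 𝓝[>] (0:ℝ), b * c < e := by
  have : Tendsto (fun b : ℝ => b * c) (𝓝[>] 0) (𝓝 0) := by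
    have h : Continuous fun b : ℝ => b * c := by fun_prop
    simpa using (h.tendsto 0).mono_left nhdsWithin_le_nhds
  exact this.eventually (gt_mem_nhds he)

set_option maxHeartbeats 800000 in
/-- Bounded subsolutions lie below bounded supersolutions. -/
theorem comparison {lam : ℝ} (hlam : 0 < lam) {ν : Space N → Measure (Space N)}
    (hν : ∀ ξ, IsLevyMeasure (ν ξ)) (hM1 : AssumptionM1 ν) (hM2 : AssumptionM2 ν)
    (hM3 : AssumptionM3 ν) (hM4 : AssumptionM4 ν) {H : Space N → Space N → ℝ} {m : ℝ} (hm : 1 < m)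
    (hH0 : AssumptionH0 H) (hH1 : AssumptionH1 H m) (hH2 : AssumptionH2 H m) {u v : Space N → ℝ}
    (hu : IsViscositySubsolution lam ν H u) (hv : IsViscositySupersolution lam ν H v)
    (x₀ : Space N) : u x₀ ≤ v x₀ := by
  by_contra hcon
  rw [not_le] at hcon
  set d := u x₀ - v x₀ with hd
  have hd0 : 0 < d := by linarith
  obtain ⟨K₁, hK₁⟩ := hu.2.1
  obtain ⟨K₂, hK₂⟩ := hv.2.1
  set K := max (max K₁ K₂) 1 with hK
  have hK1 : 1 ≤ K := le_max_right _ _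
  have hK0 : 0 < K := by linarith
  have huK : ∀ x, |u x| ≤ K := fun x => (hK₁ x).trans ((le_max_left _ _).trans (le_max_left _ _))
  have hvK : ∀ x, |v x| ≤ K := fun x => (hK₂ x).trans ((le_max_right _ _).trans (le_max_left _ _))
  obtain ⟨Cν, hCν0, hCν⟩ := hM1.exists_bound
  obtain ⟨β, hβ, hgain⟩ := exists_hamiltonian_gain hm hH0 hH1 hH2
  obtain ⟨θ, hθ0, hθ1, hgain⟩ := hgain (lam * d / 8) (by positivity)
  -- Close enough to 1 that the Hamiltonian gain has error `λd/8` and that scaling `u` by `μ` loses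
  -- at most `d/4` of the gap `d`.
  set μ := 1 - min θ (d / (4 * K)) with hμ
  have hmin : 0 < min θ (d / (4 * K)) := by positivity
  have hμ1 : μ < 1 := by linarith
  have hμθ : 1 - θ ≤ μ := by have := min_le_left θ (d / (4 * K)); linarith
  have hμ0 : 0 < μ := by linarith
  have hμd : (1 - μ) * K ≤ d / 4 := by
    have h1 : 1 - μ ≤ d / (4 * K) := by have := min_le_right θ (d / (4 * K)); linarith
    calc (1 - μ) * K ≤ d / (4 * K) * K := by gcongr
      _ = d / 4 := by field_simp
  obtain ⟨ω₁, ω₂, hω₁, hω₂, hH⟩ := hH1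
  have hμ' : 0 < 1 - μ := by linarith
  -- With `T = |P|^m`, the error terms below add up to at most `10e + 4eT`. The first entry of the
  -- minimum lets the gain `(1-μ)βT` absorb the part in `T`, the second bounds the constant part by
  -- `λd/8`. What remains is `λd/2 ≤ λd/4`, a contradiction.
  set e := min ((1 - μ) * β) (lam * d / 8) / 10 with he
  have he0 : 0 < e := by positivity
  have he1 : 10 * e ≤ (1 - μ) * β := by
    have := min_le_left ((1 - μ) * β) (lam * d / 8); linarith
  have he2 : 10 * e ≤ lam * d / 8 := by
    have := min_le_right ((1 - μ) * β) (lam * d / 8); linarith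
  obtain ⟨ρ, hρ0, hρ1, hcoup⟩ := hM4.exists_radius he0
  set r := ρ / 2 with hr
  have hr0 : 0 < r := by positivity
  have hr1 : r < 1 := by linarith
  obtain ⟨R, hR1, hR⟩ := hM2.exists_radius (show 0 < e / (4 * K) by positivity)
  obtain ⟨s₁, hs₁, hω₁'⟩ := hω₁.exists_lt he0
  obtain ⟨s₂, hs₂, hω₂'⟩ := hω₂.exists_lt he0
  set τ := e / (4 * K + 4) with hτ
  have hτ0 : 0 < τ := by positivity
  obtain ⟨s₃, hs₃, hTV⟩ := hM3.exists_dist hr0 (hr1.trans hR1) hτ0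
  set s := min s₁ s₃ with hs
  have hs0 : 0 < s := by positivity
  -- A nonnegative maximum forces `α|x - y|² ≤ 2K`, so this value already gives `|x - y| < s`.
  set α := 4 * K / s ^ 2 with hα
  have hα0 : 0 < α := by positivity
  set L := 8 * K with hL
  have hL0 : 0 ≤ L := by positivity
  -- Chosen last: `b` must make the localizer errors small against `R`, `r` and `Cν`, and keep
  -- `ψ(x₀)` below `d/4`.
  obtain ⟨b, ⟨⟨⟨⟨⟨hb1, hbs⟩, hbl⟩, hbr⟩, hbν⟩, hbx⟩, hb0⟩ :=
    ((((((eventually_mul_lt 1 zero_lt_one).and (eventually_mul_lt L hs₂)).and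
    (eventually_mul_lt L zero_lt_one)).and
    (eventually_mul_lt ((L * R ^ 2 + L * R) * (Cν / r ^ 2)) he0)).and
    (eventually_mul_lt (L * Cν) he0)).and (eventually_mul_lt (L * ‖x₀‖ ^ 2)
    (show 0 < d / 4 by positivity))).and self_mem_nhdsWithin |>.exists
  replace hb0 : 0 < b := hb0
  rw [mul_one] at hb1
  have hbsq : b ^ 2 ≤ b := by nlinarith
  have hψ₀ : localizer L b x₀ ≤ d / 4 := by
    refine (localizer_le hL0 x₀).trans ?_
    have : L * b ^ 2 * ‖x₀‖ ^ 2 ≤ L * b * ‖x₀‖ ^ 2 := by gcongr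
    linarith
  have hΦ₀ : d / 2 ≤ μ * u x₀ - v x₀ - localizer L b x₀ := by
    have h1 := abs_le.1 (huK x₀)
    have h2 : (1 - μ) * u x₀ ≤ (1 - μ) * K := mul_le_mul_of_nonneg_left h1.2 hμ'.le
    linarith
  obtain ⟨x, y, hmax⟩ := exists_doubling_max hu.1 hv.1 hK0 huK hvK hα0 hb0 hμ0 hμ1.le
    (x₀ := x₀) (by linarith)
  have hm0 := hmax x₀ x₀
  rw [sub_self, norm_zero] at hm0
  have hψ := localizer_nonneg (b := b) hL0 x
  have hαn : 0 ≤ α * ‖x - y‖ ^ 2 := by positivity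
  have hval : d / 2 ≤ μ * u x - v y := by linarith
  have hxy : ‖x - y‖ < s := by
    have h1 := abs_le.1 (huK x)
    have h2 := abs_le.1 (hvK y)
    have h3 : α * ‖x - y‖ ^ 2 ≤ 2 * K := by
      have := mul_le_mul_of_nonneg_left h1.2 hμ0.le
      have := mul_le_mul_of_nonneg_right hμ1.le hK0.le
      linarith
    have h4 : α * s ^ 2 = 4 * K := by rw [hα]; field_simp
    refine lt_of_pow_lt_pow_left₀ 2 hs0.le ?_
    by_contra h5
    rw [not_lt] at h5
    have := mul_le_mul_of_nonneg_left h5 hα0.le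
    linarith
  -- The slack `e/(2α)` contributes exactly `e` after multiplication by `2α`.
  obtain ⟨γ, hγ, hγi, hγw⟩ := hcoup r hr0 (by linarith) x y (e / (2 * α)) (by positivity)
  have hest := doubling_estimate hν hu hv huK hvK hL0 hα0.le hb0.le hμ0 hμ1.le hr0 hr1 hR1 hτ0.le
    hmax hγ hγi hγw (hTV x y (hxy.trans_le (min_le_right _ _))) hR hCν
  set p := (2 * α) • (x - y) with hp
  set q := localizerGrad L b x with hq
  set P := p + q with hP
  have hqn : ‖q‖ ≤ b * L := by
    have := norm_localizerGrad_le hL0 hb0.le x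
    linarith
  have hpn : ‖p‖ = 2 * α * ‖x - y‖ := by
    rw [hp, norm_smul, Real.norm_eq_abs, abs_of_pos (by positivity)]
  -- (H1) is centred at `P`, not at `p`, so that its errors are powers of the same `|P|` as the
  -- gain.
  have hHam := hH x y P (-q) (by rw [norm_neg]; linarith)
  rw [show P + -q = p by rw [hP]; abel, nnnorm_neg] at hHam
  have hg := hgain μ hμθ hμ1 x P
  set T := ‖P‖ ^ m with hT
  have hT0 : 0 ≤ T := by positivity
  have hPT : ‖P‖ ≤ 1 + T := by
    by_cases h : ‖P‖ ≤ 1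
    · linarith
    · have := Real.self_le_rpow_of_one_le (not_le.1 h).le hm.le
      linarith
  have hPT' : ‖P‖ ^ (m - 1) ≤ 1 + T := by
    by_cases h : ‖P‖ ≤ 1
    · have := Real.rpow_le_one (norm_nonneg P) h (show 0 ≤ m - 1 by linarith)
      linarith
    · have := Real.rpow_le_rpow_of_exponent_le (not_le.1 h).le (show m - 1 ≤ m by linarith)
      linarith
  have hpP : ‖p‖ ≤ ‖P‖ + 1 := by
    have h1 : p = P - q := by rw [hP]; abel
    have h2 := norm_sub_le P q
    rw [← h1] at h2
    linarith
  have z1 : 2 * α * (e * ‖x - y‖ + e / (2 * α)) ≤ e * (2 + T) + e := by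
    have : 2 * α * (e * ‖x - y‖ + e / (2 * α)) = e * ‖p‖ + e := by
      rw [hpn]; field_simp
    rw [this]
    gcongr
    linarith
  have z2 : L * b ^ 2 * Cν ≤ e := by
    have : L * b ^ 2 * Cν ≤ L * b * Cν := by gcongr
    linarith
  have z3 : (L * b ^ 2 * R ^ 2 + L * b * R) * (Cν / r ^ 2) ≤ e := by
    have : (L * b ^ 2 * R ^ 2 + L * b * R) * (Cν / r ^ 2) ≤
      (L * b * R ^ 2 + L * b * R) * (Cν / r ^ 2) := by gcongr
    linarith
  have z4 : 2 * (2 * K + ‖p‖) * τ ≤ e * (1 + T) := by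
    have h1 : 2 * (2 * K + ‖p‖) ≤ (4 * K + 4) * (1 + T) := by
      have := mul_nonneg hK0.le hT0
      linarith
    calc 2 * (2 * K + ‖p‖) * τ ≤ (4 * K + 4) * (1 + T) * τ := by gcongr
      _ = e * (1 + T) := by rw [hτ]; field_simp
  have z5 : 2 * (2 * K) * (e / (4 * K)) = e := by field_simp; ring
  have z6 : (ω₁ ‖x - y‖₊ : ℝ) * (1 + T) ≤ e * (1 + T) := by
    have := hω₁' ‖x - y‖₊ (by simpa using hxy.trans_le (min_le_left _ _))
    gcongr
  have z7 : (ω₂ ‖q‖₊ : ℝ) * (1 + ‖P‖ ^ (m - 1)) ≤ e * (2 + T) := by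
    have := hω₂' ‖q‖₊ (by rw [coe_nnnorm]; linarith)
    exact mul_le_mul this.le (by linarith) (by positivity) he0.le
  have z8 : 10 * e * T ≤ (1 - μ) * β * T := by gcongr
  have z9 : lam * (d / 2) ≤ lam * (μ * u x - v y) := by gcongr
  have z10 : 0 ≤ e * T := by positivity
  have z11 : 0 < lam * d := by positivity
  linarith

/-! ### Constant sub- and supersolutions -/

/-- Where `c - φ` is maximal, `Dφ` vanishes and the increments of `φ` on the ball are nonnegative,
so the nonlocal term has the favourable sign and only `H(x, 0)` remains. -/
lemma isViscositySubsolution_const {lam : ℝ} {ν : Space N → Measure (Space N)}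
    (hν : ∀ ξ, IsLevyMeasure (ν ξ)) {H : Space N → Space N → ℝ} {c : ℝ}
    (hc : ∀ x, lam * c + H x 0 ≤ 0) : IsViscositySubsolution lam ν H (fun _ => c) := by
  refine ⟨continuous_const.upperSemicontinuous, ⟨|c|, fun _ => le_rfl⟩, ?_⟩
  intro φ x δ hδ hφ hφK hmax
  rw [viscExpr_eq_jumpExpr lam hν H hδ measurable_const ⟨|c|, fun _ => le_rfl⟩ hφ
    (hφK.imp fun _ h y _ => h y)]
  have hg : gradient φ x = 0 := by
    rw [← gradient_eq_of_isLocalMax_sub (f := fun _ => c) (differentiableAt_const c)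
      ((hφ.contDiffAt (ball_mem_nhds x hδ)).differentiableAt (by simp))
      (by filter_upwards [ball_mem_nhds x hδ] with y hy using hmax y hy)]
    exact gradient_fun_const x c
  have h0 : 0 ≤ ∫ z, jump (fun _ => c) φ c x (gradient φ x) δ z ∂(ν x) := by
    refine integral_nonneg fun z => ?_
    rw [hg]
    simp only [jump, inner_zero_left, Set.indicator_zero, sub_zero, sub_self]
    split_ifs with hz
    · have := hmax (x + z) (by simpa using hz)
      show 0 ≤ φ (x + z) - φ x
      linarith
    · exact le_rfl
  have := hc x
  rw [jumpExpr]
  rw [hg] at *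
  linarith

lemma isViscositySupersolution_const {lam : ℝ} {ν : Space N → Measure (Space N)}
    (hν : ∀ ξ, IsLevyMeasure (ν ξ)) {H : Space N → Space N → ℝ} {c : ℝ}
    (hc : ∀ x, 0 ≤ lam * c + H x 0) : IsViscositySupersolution lam ν H (fun _ => c) := by
  refine ⟨continuous_const.lowerSemicontinuous, ⟨|c|, fun _ => le_rfl⟩, ?_⟩
  intro φ x δ hδ hφ hφK hmin
  rw [viscExpr_eq_jumpExpr lam hν H hδ measurable_const ⟨|c|, fun _ => le_rfl⟩ hφ
    (hφK.imp fun _ h y _ => h y)]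
  have hg : gradient φ x = 0 := by
    rw [gradient_eq_of_isLocalMax_sub (g := fun _ => c)
      ((hφ.contDiffAt (ball_mem_nhds x hδ)).differentiableAt (by simp)) (differentiableAt_const c)
      (by filter_upwards [ball_mem_nhds x hδ] with y hy; linarith [hmin y hy])]
    exact gradient_fun_const x c
  have h0 : ∫ z, jump (fun _ => c) φ c x (gradient φ x) δ z ∂(ν x) ≤ 0 := by
    refine integral_nonpos fun z => ?_
    rw [hg]
    simp only [jump, inner_zero_left, Set.indicator_zero, sub_zero, sub_self]
    split_ifs with hz
    · have := hmin (x + z) (by simpa using hz)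
      show φ (x + z) - φ x ≤ 0
      linarith
    · exact le_rfl
  have := hc x
  rw [jumpExpr]
  rw [hg] at *
  linarith

/-! ### Changing the radius -/

/-- On the annulus between the radii, shrinking the ball replaces increments of `φ` by the smaller
increments of `u`. The subsolution inequality is thus strongest at small radius, and proving it
there suffices. -/
lemma jumpExpr_le_of_le_radius {lam : ℝ} {ν : Space N → Measure (Space N)}
    (hν : ∀ ξ, IsLevyMeasure (ν ξ)) {H : Space N → Space N → ℝ} {u φ : Space N → ℝ} {x : Space N}
    {s δ : ℝ} (hs : 0 < s) (hsδ : s ≤ δ) (hu : Measurable u) (huK : IsBddFun u)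
    (hφ : ContDiffOn ℝ 2 φ (ball x δ)) (hφK : ∃ K, ∀ y ∈ ball x δ, |φ y| ≤ K)
    (hmax : ∀ y ∈ ball x δ, u y - φ y ≤ u x - φ x) :
    jumpExpr lam ν H u φ (u x) x δ ≤ jumpExpr lam ν H u φ (u x) x s := by
  obtain ⟨C, hC⟩ := exists_levyBounded_jump (u x) (hs.trans_le hsδ) hu huK hφ hφK
  obtain ⟨C', hC'⟩ := exists_levyBounded_jump (u x) hs hu huK
    (hφ.mono (ball_subset_ball hsδ)) (hφK.imp fun _ h y hy => h y (ball_subset_ball hsδ hy))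
  refine jumpExpr_mono rfl (hC'.integrable (hν x)) (hC.integrable (hν x)) fun z => ?_
  by_cases h1 : ‖z‖ < s
  · rw [if_pos h1, if_pos (h1.trans_le hsδ)]
  · rw [if_neg h1]
    split_ifs with h2
    · have := hmax (x + z) (by simpa using h2)
      linarith
    · exact le_rfl

lemma jumpExpr_le_of_radius_le {lam : ℝ} {ν : Space N → Measure (Space N)}
    (hν : ∀ ξ, IsLevyMeasure (ν ξ)) {H : Space N → Space N → ℝ} {u φ : Space N → ℝ} {x : Space N}
    {s δ : ℝ} (hs : 0 < s) (hsδ : s ≤ δ) (hu : Measurable u) (huK : IsBddFun u)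
    (hφ : ContDiffOn ℝ 2 φ (ball x δ)) (hφK : ∃ K, ∀ y ∈ ball x δ, |φ y| ≤ K)
    (hmin : ∀ y ∈ ball x δ, u x - φ x ≤ u y - φ y) :
    jumpExpr lam ν H u φ (u x) x s ≤ jumpExpr lam ν H u φ (u x) x δ := by
  obtain ⟨C, hC⟩ := exists_levyBounded_jump (u x) (hs.trans_le hsδ) hu huK hφ hφK
  obtain ⟨C', hC'⟩ := exists_levyBounded_jump (u x) hs hu huK
    (hφ.mono (ball_subset_ball hsδ)) (hφK.imp fun _ h y hy => h y (ball_subset_ball hsδ hy))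
  refine jumpExpr_mono rfl (hC.integrable (hν x)) (hC'.integrable (hν x)) fun z => ?_
  by_cases h1 : ‖z‖ < s
  · rw [if_pos h1, if_pos (h1.trans_le hsδ)]
  · rw [if_neg h1]
    split_ifs with h2
    · have := hmin (x + z) (by simpa using h2)
      linarith
    · exact le_rfl

/-! ### Semicontinuity of the equation -/

/-- `φ` is of class `C²` and bounded on the ball, with a uniform second order Taylor bound. -/
structure IsTestOn (φ : Space N → ℝ) (x : Space N) (t C K : ℝ) : Prop where
  contDiffOn : ContDiffOn ℝ 2 φ (ball x t)
  nonneg : 0 ≤ C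
  taylor : ∀ y z, y ∈ ball x t → y + z ∈ ball x t →
    |φ (y + z) - φ y - inner ℝ (gradient φ y) z| ≤ C * ‖z‖ ^ 2
  bound : ∀ y ∈ ball x t, |φ y| ≤ K

lemma exists_isTestOn {φ : Space N → ℝ} {x : Space N} {δ K : ℝ} (hδ : 0 < δ)
    (hφ : ContDiffOn ℝ 2 φ (ball x δ)) (hK : ∀ y ∈ ball x δ, |φ y| ≤ K) :
    ∃ t > 0, t ≤ δ ∧ ∃ C, IsTestOn φ x t C K := by
  obtain ⟨ρ, hρ, C, hC, hT⟩ := exists_taylor_bound (hφ.contDiffAt (ball_mem_nhds x hδ))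
  have h1 : ball x (min ρ δ) ⊆ ball x ρ := ball_subset_ball (min_le_left _ _)
  have h2 : ball x (min ρ δ) ⊆ ball x δ := ball_subset_ball (min_le_right _ _)
  exact ⟨min ρ δ, by positivity, min_le_right _ _, C, hφ.mono h2, hC,
    fun y z hy hz => hT y z (h1 hy) (h1 hz), fun y hy => hK y (h2 hy)⟩

lemma IsTestOn.neg {φ : Space N → ℝ} {x : Space N} {t C K : ℝ} (h : IsTestOn φ x t C K) :
    IsTestOn (fun y => -φ y) x t C K := by
  have hg : ∀ y, gradient (fun y => -φ y) y = -gradient φ y := fun y => by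
    rw [gradient, gradient, fderiv_fun_neg, map_neg]
  refine ⟨h.contDiffOn.neg, h.nonneg, fun y z hy hz => ?_, fun y hy => ?_⟩
  · rw [hg, inner_neg_left, ← abs_neg]
    convert h.taylor y z hy hz using 2
    ring
  · rw [abs_neg]
    exact h.bound y hy

/-- The duality `u ↦ -u`, `H(x,p) ↦ -H(x,-p)` exchanges sub- and supersolutions, so one
semicontinuity statement serves both directions. -/
lemma jumpExpr_neg (lam : ℝ) (ν : Space N → Measure (Space N)) (H : Space N → Space N → ℝ)
    (u φ : Space N → ℝ) (a : ℝ) (x : Space N) (δ : ℝ) :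
    jumpExpr lam ν (fun x p => -H x (-p)) (fun y => -u y) (fun y => -φ y) (-a) x δ =
      -jumpExpr lam ν H u φ a x δ := by
  have hg : gradient (fun y => -φ y) x = -gradient φ x := by
    rw [gradient, gradient, fderiv_fun_neg, map_neg]
  have hj : ∀ z, jump (fun y => -u y) (fun y => -φ y) (-a) x (-gradient φ x) δ z =
      -jump u φ a x (gradient φ x) δ z := by
    intro z
    have : (ball (0 : Space N) 1).indicator (fun w => inner ℝ (-gradient φ x) w) z =
        -(ball (0 : Space N) 1).indicator (fun w => inner ℝ (gradient φ x) w) z := by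
      simp only [inner_neg_left]
      exact congrFun (Set.indicator_neg _ _) z
    unfold jump
    rw [this]
    split_ifs <;> ring
  rw [jumpExpr, jumpExpr, hg, neg_neg]
  simp only [hj, integral_neg]
  ring

/-- Since `u i ≤ V` with `V` upper semicontinuous, the limsup of the integrands is at most the
integrand of `V`; `eventually_integral_le` carries this through the moving measures. The condition
`2s ≤ t` keeps the balls `B_s(y i)` inside the region of the uniform Taylor bound. -/
lemma eventually_jumpExpr_ge (lam : ℝ) {ν : Space N → Measure (Space N)}
    (hν : ∀ ξ, IsLevyMeasure (ν ξ)) (hM2 : AssumptionM2 ν) (hM3 : AssumptionM3 ν)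
    (hM4 : AssumptionM4 ν) {H : Space N → Space N → ℝ}
    (hH : Continuous (fun q : Space N × Space N => H q.1 q.2))
    {ι : Type*} {l : Filter ι} [l.IsCountablyGenerated] {y : ι → Space N} {x : Space N}
    (hy : Tendsto y l (𝓝 x)) {a : ι → ℝ} {a₀ : ℝ} (ha : Tendsto a l (𝓝 a₀))
    {u : ι → Space N → ℝ} {V : Space N → ℝ} {K : ℝ} (hum : ∀ i, Measurable (u i))
    (huK : ∀ i y, |u i y| ≤ K) (hV : UpperSemicontinuous V) (hVK : ∀ y, |V y| ≤ K)
    (huV : ∀ i y, u i y ≤ V y) {φ : Space N → ℝ} {t s C K' : ℝ} (hφ : IsTestOn φ x t C K')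
    (hs : 0 < s) (hs1 : s ≤ 1) (hst : 2 * s ≤ t) {e : ℝ} (he : 0 < e) :
    ∀ᶠ i in l, jumpExpr lam ν H V φ a₀ x s - e ≤ jumpExpr lam ν H (u i) φ (a i) (y i) s := by
  have ht : 0 < t := by linarith
  have hcd : ContDiffAt ℝ 2 φ x := hφ.contDiffOn.contDiffAt (ball_mem_nhds x ht)
  have hp : Tendsto (fun i => gradient φ (y i)) l (𝓝 (gradient φ x)) :=
    (continuousAt_gradient hcd).tendsto.comp hy
  set M := max (max K K') (|a₀| + 1) with hM
  have hMK : K ≤ M := (le_max_left _ _).trans (le_max_left _ _)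
  have hMK' : K' ≤ M := (le_max_right _ _).trans (le_max_left _ _)
  have hMa : |a₀| + 1 ≤ M := le_max_right _ _
  have hM0 : 0 ≤ M := by linarith [abs_nonneg a₀]
  set P := ‖gradient φ x‖ + 1 with hP
  have hD : 0 < C + (2 * M + P) / s ^ 2 := by
    have := hφ.nonneg
    have h1 : 0 < (2 * M + P) / s ^ 2 := by positivity
    linarith
  have hsub : ∀ y₀, y₀ ∈ ball x s → ball y₀ s ⊆ ball x t := fun y₀ h₀ w hw => by
    rw [mem_ball] at *
    linarith [dist_triangle w y₀ x]
  have hLB : ∀ (w : Space N → ℝ) (c : ℝ) (y₀ : Space N), Measurable w → (∀ z, |w z| ≤ K) →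
      |c| ≤ M → y₀ ∈ ball x s → ‖gradient φ y₀‖ ≤ P →
      LevyBounded (C + (2 * M + P) / s ^ 2) (jump w φ c y₀ (gradient φ y₀) s) := by
    intro w c y₀ hw hwK hc hy₀ hp₀
    refine levyBounded_jump hw (hφ.contDiffOn.continuousOn.mono (hsub y₀ hy₀))
      (fun z => (hwK z).trans hMK) hc (fun z hz => (hφ.bound z (hsub y₀ hy₀ hz)).trans hMK') hp₀ hs
      hs1 le_rfl hφ.nonneg fun z hz => hφ.taylor y₀ z (hsub y₀ hy₀ (mem_ball_self hs))
        (hsub y₀ hy₀ (by simpa using hz))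
  have hin : ∀ z, Tendsto (fun i => (ball (0 : Space N) 1).indicator
      (fun w => inner ℝ (gradient φ (y i)) w) z) l
      (𝓝 ((ball (0 : Space N) 1).indicator (fun w => inner ℝ (gradient φ x) w) z)) := by
    intro z
    by_cases hz : z ∈ ball (0 : Space N) 1
    · simp only [Set.indicator_of_mem hz]
      exact hp.inner tendsto_const_nhds
    · simp only [Set.indicator_of_notMem hz]
      exact tendsto_const_nhds
  have hint := eventually_integral_le hν hM2 hM3 hM4 hy hD
    (F := fun i => jump (u i) φ (a i) (y i) (gradient φ (y i)) s)
    (G := jump V φ a₀ x (gradient φ x) s)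
    (by
      filter_upwards [hy.eventually (ball_mem_nhds x hs),
        ha.abs.eventually (gt_mem_nhds (show |a₀| < |a₀| + 1 by linarith)),
        hp.norm.eventually (gt_mem_nhds (show ‖gradient φ x‖ < P by linarith))] with i h1 h2 h3
      exact hLB _ _ _ (hum i) (huK i) (h2.le.trans hMa) h1 h3.le)
    (hLB _ _ _ hV.measurable hVK (by linarith) (mem_ball_self hs) (by linarith))
    (by
      intro z η hη
      have hin' := (hin z).eventually (lt_mem_nhds (show (ball (0 : Space N) 1).indicator
        (fun w => inner ℝ (gradient φ x) w) z - η / 3 < _ by linarith))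
      by_cases hz : ‖z‖ < s
      · have hxz : x + z ∈ ball x t := hsub x (mem_ball_self hs) (by simpa using hz)
        have c1 : Tendsto (fun i => φ (y i + z) - φ (y i)) l (𝓝 (φ (x + z) - φ x)) := by
          have c2 : ContinuousAt φ (x + z) :=
            hφ.contDiffOn.continuousOn.continuousAt (isOpen_ball.mem_nhds hxz)
          exact (c2.tendsto.comp (hy.add_const z)).sub (hcd.continuousAt.tendsto.comp hy)
        filter_upwards [c1.eventually (gt_mem_nhds (show _ < φ (x + z) - φ x + η / 3 by linarith)),
          hin'] with i h1 h2
        simp only [jump, if_pos hz]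
        linarith
      · have c1 := (hy.add_const z).eventually (hV (x + z) (V (x + z) + η / 3)
          (show V (x + z) < V (x + z) + η / 3 by linarith))
        filter_upwards [c1, hin', ha.eventually (lt_mem_nhds (show a₀ - η / 3 < a₀ by linarith))]
          with i h1 h2 h3
        have h4 := huV i (y i + z)
        simp only [jump, if_neg hz]
        linarith)
    (show 0 < e / 3 by positivity)
  have hHt : Tendsto (fun i => H (y i) (gradient φ (y i))) l (𝓝 (H x (gradient φ x))) :=
    (hH.tendsto (x, gradient φ x)).comp (hy.prodMk_nhds hp)
  filter_upwards [hint, hHt.eventually (lt_mem_nhds (show H x (gradient φ x) - e / 3 < _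
    by linarith)), (ha.const_mul lam).eventually (lt_mem_nhds (show lam * a₀ - e / 3 < _
    by linarith))] with i h1 h2 h3
  unfold jumpExpr
  linarith

/-! ### Envelopes -/

/-- The envelope is the limsup over full neighbourhoods, centre included, and therefore dominates
`f`. -/
lemma exists_upper_envelope {f : Space N → ℝ} {K : ℝ} (hf : ∀ x, |f x| ≤ K) :
    ∃ V : Space N → ℝ, UpperSemicontinuous V ∧ (∀ x, f x ≤ V x) ∧ (∀ x, |V x| ≤ K) ∧
      ∀ x, ∀ η > 0, ∃ y, ‖y - x‖ < η ∧ V x - η < f y := by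
  have hb : ∀ x, IsBoundedUnder (· ≤ ·) (𝓝 x) f := fun x =>
    ⟨K, eventually_map.2 (Eventually.of_forall fun y => (abs_le.1 (hf y)).2)⟩
  have hb' : ∀ x, IsBoundedUnder (· ≥ ·) (𝓝 x) f := fun x =>
    ⟨-K, eventually_map.2 (Eventually.of_forall fun y => (abs_le.1 (hf y)).1)⟩
  have hc : ∀ x, IsCoboundedUnder (· ≤ ·) (𝓝 x) f := fun x => (hb' x).isCoboundedUnder_le
  have hle : ∀ x c, (∀ᶠ y in 𝓝 x, f y ≤ c) → limsup f (𝓝 x) ≤ c := fun x c h =>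
    limsup_le_of_le (hc x) h
  have hfV : ∀ x, f x ≤ limsup f (𝓝 x) := fun x => by
    by_contra h
    rw [not_le] at h
    exact lt_irrefl _ (eventually_lt_of_limsup_lt h (hb x)).self_of_nhds
  refine ⟨fun x => limsup f (𝓝 x), ?_, hfV, fun x => abs_le.2 ⟨(abs_le.1 (hf x)).1.trans (hfV x),
    hle x K (Eventually.of_forall fun y => (abs_le.1 (hf y)).2)⟩, fun x η hη => ?_⟩
  · intro x c hc
    obtain ⟨c', h1, h2⟩ := exists_between (show limsup f (𝓝 x) < c from hc)
    filter_upwards [(eventually_lt_of_limsup_lt h1 (hb x)).eventually_nhds] with y hy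
    exact (hle y c' (hy.mono fun _ h => h.le)).trans_lt h2
  · have h1 : ∃ᶠ y in 𝓝 x, limsup f (𝓝 x) - η < f y :=
      frequently_lt_of_lt_limsup (hc x) (by linarith)
    obtain ⟨y, h2, h3⟩ := (h1.and_eventually (ball_mem_nhds x hη)).exists
    exact ⟨y, by rwa [dist_eq_norm] at h3, h2⟩

lemma exists_lower_envelope {f : Space N → ℝ} {K : ℝ} (hf : ∀ x, |f x| ≤ K) :
    ∃ V : Space N → ℝ, LowerSemicontinuous V ∧ (∀ x, V x ≤ f x) ∧ (∀ x, |V x| ≤ K) ∧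
      ∀ x, ∀ η > 0, ∃ y, ‖y - x‖ < η ∧ f y < V x + η := by
  obtain ⟨V, h1, h2, h3, h4⟩ := exists_upper_envelope (f := fun x => -f x) (K := K)
    (fun x => by rw [abs_neg]; exact hf x)
  refine ⟨fun x => -V x, ?_, fun x => by linarith [h2 x], fun x => by rw [abs_neg]; exact h3 x,
    fun x η hη => ?_⟩
  · intro x c hc
    have hc' : V x < -c := by have : c < -V x := hc; linarith
    filter_upwards [h1 x (-c) hc'] with y hy
    linarith
  · obtain ⟨y, h5, h6⟩ := h4 x η hη
    exact ⟨y, h5, by linarith⟩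

lemma contDiffOn_add_mul_norm_sub_sq {φ : Space N → ℝ} {x : Space N} {δ : ℝ}
    (hφ : ContDiffOn ℝ 2 φ (ball x δ)) (c : Space N) (η : ℝ) :
    ContDiffOn ℝ 2 (fun y => φ y + η * ‖y - c‖ ^ 2) (ball x δ) :=
  hφ.add (contDiff_const.mul ((contDiff_norm_sq ℝ).comp
    (contDiff_id.sub contDiff_const))).contDiffOn

lemma abs_add_mul_norm_sub_sq_le {φ : Space N → ℝ} {x : Space N} {δ K : ℝ} (hδ1 : δ ≤ 1)
    (hφ : ∀ y ∈ ball x δ, |φ y| ≤ K) (η : ℝ) :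
    ∀ y ∈ ball x δ, |φ y + η * ‖y - x‖ ^ 2| ≤ K + |η| := by
  intro y hy
  have h1 := hφ y hy
  rw [mem_ball_iff_norm] at hy
  have h2 : |η * ‖y - x‖ ^ 2| ≤ |η| := by
    rw [abs_mul, abs_of_nonneg (sq_nonneg ‖y - x‖)]
    exact mul_le_of_le_one_right (abs_nonneg _) (by nlinarith [norm_nonneg (y - x)])
  exact (abs_add_le _ _).trans (by linarith)

/-! ### Stability of subsolutions -/

/-- An upper semicontinuous function approximated from below by subsolutions is a subsolution. -/
theorem isViscositySubsolution_of_approx {lam : ℝ} {ν : Space N → Measure (Space N)}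
    (hν : ∀ ξ, IsLevyMeasure (ν ξ)) (hM2 : AssumptionM2 ν) (hM3 : AssumptionM3 ν)
    (hM4 : AssumptionM4 ν) {H : Space N → Space N → ℝ}
    (hH : Continuous (fun q : Space N × Space N => H q.1 q.2)) {S : Set (Space N → ℝ)}
    (hS : ∀ w ∈ S, IsViscositySubsolution lam ν H w) {K : ℝ} (hSK : ∀ w ∈ S, ∀ x, |w x| ≤ K)
    {V : Space N → ℝ} (hV : UpperSemicontinuous V) (hVK : ∀ x, |V x| ≤ K)
    (hle : ∀ w ∈ S, ∀ x, w x ≤ V x)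
    (happ : ∀ x, ∀ η > 0, ∃ y, ‖y - x‖ < η ∧ ∃ w ∈ S, V x - η < w y) :
    IsViscositySubsolution lam ν H V := by
  refine ⟨hV, ⟨K, hVK⟩, fun φ x δ₀ hδ₀ hφ₀ hφK₀ hmax₀ => ?_⟩
  rw [viscExpr_eq_jumpExpr lam hν H hδ₀ hV.measurable ⟨K, hVK⟩ hφ₀ (hφK₀.imp fun _ h y _ => h y)]
  set δ := min δ₀ 1 with hδ
  have hδ0 : 0 < δ := by positivity
  have hδ1 : δ ≤ 1 := min_le_right _ _
  have hδδ : δ ≤ δ₀ := min_le_left _ _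
  refine (jumpExpr_le_of_le_radius hν hδ0 hδδ hV.measurable ⟨K, hVK⟩ hφ₀
    (hφK₀.imp fun _ h y _ => h y) hmax₀).trans ?_
  have hφ := hφ₀.mono (ball_subset_ball hδδ)
  have hmax : ∀ y ∈ ball x δ, V y - φ y ≤ V x - φ x := fun y hy =>
    hmax₀ y (ball_subset_ball hδδ hy)
  obtain ⟨Kφ, hKφ₀⟩ := hφK₀
  have hKφ : ∀ y ∈ ball x δ, |φ y| ≤ Kφ := fun y _ => hKφ₀ y
  clear hmax₀ hφ₀ hKφ₀
  -- Adding `η|y - x|²` makes the maximum at `x` strict and changes the expression by at most `η ∫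
  -- min(1,|z|²) dν_x`, which vanishes with `η`.
  suffices key : ∀ η > 0, jumpExpr lam ν H V (fun y => φ y + η * ‖y - x‖ ^ 2) (V x) x δ ≤ 0 by
    set W := ∫ z, levyWeight z ∂(ν x) with hW
    have hW0 : 0 ≤ W := integral_nonneg levyWeight_nonneg
    refine le_of_forall_pos_le_add fun e he => ?_
    have h1 := key (e / (W + 1)) (by positivity)
    have h2 := abs_jumpExpr_add_sq_sub_le lam hν H (a := V x) hδ0 hδ1 hV.measurable ⟨K, hVK⟩ hφ
      ⟨Kφ, hKφ⟩ (e / (W + 1))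
    rw [abs_of_pos (show 0 < e / (W + 1) by positivity)] at h2
    have h3 : e / (W + 1) * W ≤ e := by
      rw [div_mul_eq_mul_div, div_le_iff₀ (by positivity)]
      nlinarith
    have h4 := (abs_le.1 h2).1
    linarith
  intro η hη
  set φη : Space N → ℝ := fun y => φ y + η * ‖y - x‖ ^ 2 with hφη
  have hφηx : φη x = φ x := by simp [hφη]
  have hcd : ContDiffOn ℝ 2 φη (ball x δ) := contDiffOn_add_mul_norm_sub_sq hφ x η
  have hbd := abs_add_mul_norm_sub_sq_le hδ1 hKφ η
  obtain ⟨t, ht, htδ, C, htest⟩ := exists_isTestOn hδ0 hcd hbd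
  -- A maximizer over the closed ball of radius `t/2` that lies within `s` of `x` has its whole
  -- `s`-ball inside that closed ball, so it is a legitimate test point.
  set s := t / 4 with hs
  have hs0 : 0 < s := by positivity
  have hmaxη : ∀ y ∈ ball x δ, V y - φη y ≤ V x - φη x := fun y hy => by
    have h1 := hmax y hy
    have h2 : 0 ≤ η * ‖y - x‖ ^ 2 := by positivity
    rw [hφηx]
    simp only [hφη]
    linarith
  refine (jumpExpr_le_of_le_radius hν hs0 (by linarith) hV.measurable ⟨K, hVK⟩ hcd
    ⟨_, hbd⟩ hmaxη).trans ?_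
  have hsubt : closedBall x (t / 2) ⊆ ball x δ := fun y hy => by
    rw [mem_closedBall] at hy; rw [mem_ball]; linarith
  have hcont : ContinuousAt φη x := hcd.continuousOn.continuousAt (ball_mem_nhds x hδ0)
  have hn : ∀ n : ℕ, (0:ℝ) < 1 / (n + 1) := fun n => by positivity
  choose xs hxs ws hwS hws using fun n : ℕ => happ x (1 / (n + 1)) (hn n)
  have hmx : ∀ n, ∃ y ∈ closedBall x (t / 2), IsMaxOn (fun y => ws n y - φη y)
      (closedBall x (t / 2)) y := fun n => by
    refine UpperSemicontinuousOn.exists_isMaxOn ⟨x, mem_closedBall_self (by positivity)⟩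
      (isCompact_closedBall _ _) ?_
    have h1 := ((hS _ (hwS n)).1.upperSemicontinuousOn (closedBall x (t / 2)))
    have h2 : ContinuousOn (fun y => -φη y) (closedBall x (t / 2)) :=
      (hcd.continuousOn.mono hsubt).neg
    exact h1.add h2.upperSemicontinuousOn
  choose ys hys hym using hmx
  have hlim0 : Tendsto (fun n : ℕ => (1 / (n + 1) : ℝ)) atTop (𝓝 0) :=
    tendsto_one_div_add_atTop_nhds_zero_nat
  have hxlim : Tendsto xs atTop (𝓝 x) := by
    rw [tendsto_iff_norm_sub_tendsto_zero]
    exact squeeze_zero (fun n => norm_nonneg _) (fun n => (hxs n).le) hlim0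
  have hφxs : Tendsto (fun n => φη (xs n)) atTop (𝓝 (φ x)) := by
    rw [← hφηx]; exact hcont.tendsto.comp hxlim
  have hxmem : ∀ᶠ n in atTop, xs n ∈ closedBall x (t / 2) :=
    hxlim.eventually (closedBall_mem_nhds x (by positivity))
  have hlow : ∀ᶠ n in atTop, V x - 1 / (n + 1) - φη (xs n) ≤ ws n (ys n) - φη (ys n) := by
    filter_upwards [hxmem] with n h1
    have h2 : ws n (xs n) - φη (xs n) ≤ ws n (ys n) - φη (ys n) := hym n h1
    linarith [hws n]
  have hup : ∀ n, ws n (ys n) - φη (ys n) ≤ V x - φ x - η * ‖ys n - x‖ ^ 2 := fun n => by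
    have h1 := hmax _ (hsubt (hys n))
    have h2 := hle _ (hwS n) (ys n)
    simp only [hφη]
    linarith
  -- `hlow` and `hup` squeeze the maximal values; the strictness term `η|ys n - x|²` must then
  -- vanish, so the maximizers converge to `x` and the values `ws n (ys n)` to `V x`.
  have hsq : Tendsto (fun n => ‖ys n - x‖ ^ 2) atTop (𝓝 0) := by
    have h1 : Tendsto (fun n : ℕ => η⁻¹ * (1 / (n + 1) + φη (xs n) - φ x)) atTop
        (𝓝 (η⁻¹ * (0 + φ x - φ x))) := ((hlim0.add hφxs).sub_const _).const_mul _
    rw [zero_add, sub_self, mul_zero] at h1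
    refine squeeze_zero' (Eventually.of_forall fun n => by positivity) ?_ h1
    filter_upwards [hlow] with n h2
    rw [← div_eq_inv_mul, le_div_iff₀ hη]
    linarith [hup n]
  have hylim : Tendsto ys atTop (𝓝 x) := by
    rw [tendsto_iff_norm_sub_tendsto_zero]
    have := hsq.sqrt
    simpa [Real.sqrt_sq (norm_nonneg _)] using this
  have hφys : Tendsto (fun n => φη (ys n)) atTop (𝓝 (φ x)) := by
    rw [← hφηx]; exact hcont.tendsto.comp hylim
  have hval : Tendsto (fun n => ws n (ys n)) atTop (𝓝 (V x)) := by
    have l1 : Tendsto (fun n : ℕ => V x - 1 / (n + 1) - φη (xs n) + φη (ys n)) atTop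
        (𝓝 (V x - 0 - φ x + φ x)) := ((hlim0.const_sub _).sub hφxs).add hφys
    have l2 : Tendsto (fun n : ℕ => V x - φ x + φη (ys n)) atTop
        (𝓝 (V x - φ x + φ x)) := hφys.const_add _
    rw [sub_zero, sub_add_cancel] at l1
    rw [sub_add_cancel] at l2
    refine tendsto_of_tendsto_of_tendsto_of_le_of_le' l1 l2 ?_ (Eventually.of_forall fun n => ?_)
    · filter_upwards [hlow] with n h1
      linarith
    · have := hup n
      have h2 : 0 ≤ η * ‖ys n - x‖ ^ 2 := by positivity
      linarith
  refine le_of_forall_pos_le_add fun e he => ?_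
  have hev := eventually_jumpExpr_ge lam hν hM2 hM3 hM4 hH hylim hval
    (fun n => (hS _ (hwS n)).1.measurable) (fun n => hSK _ (hwS n)) hV hVK
    (fun n => hle _ (hwS n)) htest hs0 (by linarith) (by linarith) he
  obtain ⟨n, h1, h2⟩ := (hev.and (hylim.eventually (ball_mem_nhds x hs0))).exists
  have hb : ball (ys n) s ⊆ closedBall x (t / 2) := fun y hy => by
    rw [mem_ball] at hy
    rw [mem_closedBall]
    have h2' : dist (ys n) x < s := h2
    linarith [dist_triangle y (ys n) x]
  have h3 := (hS _ (hwS n)).jumpExpr_le hν hs0 (hcd.mono (hb.trans hsubt))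
    ⟨_, fun y hy => hbd y (hsubt (hb hy))⟩ (fun y hy => hym n (hb hy))
  linarith

/-! ### Maximal subsolutions -/

/-- The lower envelope of a maximal subsolution is a supersolution. -/
theorem isViscositySupersolution_of_maximal {lam : ℝ} {ν : Space N → Measure (Space N)}
    (hν : ∀ ξ, IsLevyMeasure (ν ξ)) (hM2 : AssumptionM2 ν) (hM3 : AssumptionM3 ν)
    (hM4 : AssumptionM4 ν) {H : Space N → Space N → ℝ}
    (hH : Continuous (fun q : Space N × Space N => H q.1 q.2)) {U V : Space N → ℝ}
    (hU : IsViscositySubsolution lam ν H U)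
    (hmaxl : ∀ w, IsViscositySubsolution lam ν H w → (∀ x, U x ≤ w x) → ∀ x, w x ≤ U x)
    {K : ℝ} (hV : LowerSemicontinuous V) (hVK : ∀ x, |V x| ≤ K) (hVU : ∀ x, V x ≤ U x)
    (happ : ∀ x, ∀ η > 0, ∃ y, ‖y - x‖ < η ∧ U y < V x + η) :
    IsViscositySupersolution lam ν H V := by
  refine ⟨hV, ⟨K, hVK⟩, fun φ x δ₀ hδ₀ hφ₀ hφK₀ hmin₀ => ?_⟩
  rw [viscExpr_eq_jumpExpr lam hν H hδ₀ hV.measurable ⟨K, hVK⟩ hφ₀ (hφK₀.imp fun _ h y _ => h y)]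
  by_contra hcon
  rw [not_le] at hcon
  set δ := min δ₀ 1 with hδ
  have hδ0 : 0 < δ := by positivity
  have hδ1 : δ ≤ 1 := min_le_right _ _
  have hδδ : δ ≤ δ₀ := min_le_left _ _
  replace hcon := (jumpExpr_le_of_radius_le hν hδ0 hδδ hV.measurable ⟨K, hVK⟩ hφ₀
    (hφK₀.imp fun _ h y _ => h y) hmin₀).trans_lt hcon
  have hφ := hφ₀.mono (ball_subset_ball hδδ)
  have hmin : ∀ y ∈ ball x δ, V x - φ x ≤ V y - φ y := fun y hy =>
    hmin₀ y (ball_subset_ball hδδ hy)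
  obtain ⟨Kφ, hKφ₀⟩ := hφK₀
  have hKφ : ∀ y ∈ ball x δ, |φ y| ≤ Kφ := fun y _ => hKφ₀ y
  clear hmin₀ hφ₀ hKφ₀
  -- Subtracting a small paraboloid makes the minimum strict; `η` is small enough to keep the
  -- expression strictly negative.
  obtain ⟨η, hη, hconη⟩ : ∃ η > 0,
      jumpExpr lam ν H V (fun y => φ y + (-η) * ‖y - x‖ ^ 2) (V x) x δ < 0 := by
    set W := ∫ z, levyWeight z ∂(ν x) with hW
    have hW0 : 0 ≤ W := integral_nonneg levyWeight_nonneg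
    set J := jumpExpr lam ν H V φ (V x) x δ with hJ
    have hJ0 : 0 < -J := by linarith
    refine ⟨-J / (W + 1), by positivity, ?_⟩
    have h2 := abs_jumpExpr_add_sq_sub_le lam hν H (a := V x) hδ0 hδ1 hV.measurable ⟨K, hVK⟩ hφ
      ⟨Kφ, hKφ⟩ (-(-J / (W + 1)))
    rw [abs_neg (-J / (W + 1)), abs_of_pos (show 0 < -J / (W + 1) by positivity)] at h2
    have h3 : -J / (W + 1) * W < -J := by
      rw [div_mul_eq_mul_div, div_lt_iff₀ (by positivity)]
      nlinarith
    have h4 := (abs_le.1 h2).2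
    linarith
  set φη : Space N → ℝ := fun y => φ y + (-η) * ‖y - x‖ ^ 2 with hφη
  have hφηx : φη x = φ x := by simp [hφη]
  have hcd : ContDiffOn ℝ 2 φη (ball x δ) := contDiffOn_add_mul_norm_sub_sq hφ x (-η)
  have hbd := abs_add_mul_norm_sub_sq_le hδ1 hKφ (-η)
  obtain ⟨t, ht, htδ, C, htest⟩ := exists_isTestOn hδ0 hcd hbd
  set s := t / 2 with hs
  have hs0 : 0 < s := by positivity
  have hminη : ∀ y ∈ ball x δ, V x - φη x ≤ V y - φη y := fun y hy => by
    have h1 := hmin y hy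
    have h2 : 0 ≤ η * ‖y - x‖ ^ 2 := by positivity
    rw [hφηx]
    simp only [hφη]
    linarith
  replace hconη := (jumpExpr_le_of_radius_le hν hs0 (by linarith) hV.measurable ⟨K, hVK⟩ hcd
    ⟨_, hbd⟩ hminη).trans_lt hconη
  set c := V x - φ x with hc
  have hcont : ContinuousAt φη x := hcd.continuousOn.continuousAt (ball_mem_nhds x hδ0)
  -- negativity of the expression for nearby points and heights
  have hneg : ∀ᶠ q : Space N × ℝ in 𝓝 (x, 0),
      jumpExpr lam ν H V φη (φη q.1 + c + q.2) q.1 s ≤ 0 := by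
    have hfst : Tendsto (fun q : Space N × ℝ => q.1) (𝓝 (x, 0)) (𝓝 x) :=
      continuous_fst.tendsto (x, (0:ℝ))
    have hsnd : Tendsto (fun q : Space N × ℝ => q.2) (𝓝 (x, 0)) (𝓝 0) :=
      continuous_snd.tendsto (x, (0:ℝ))
    have ha : Tendsto (fun q : Space N × ℝ => -(φη q.1 + c + q.2)) (𝓝 (x, 0)) (𝓝 (-V x)) := by
      have h1 := (((hcont.tendsto.comp hfst).add_const c).add hsnd).neg
      rw [hφηx, hc, add_zero, add_sub_cancel] at h1
      exact h1
    have hVn : UpperSemicontinuous fun y => -V y := by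
      intro y b hb
      have hb' : -b < V y := by have : -V y < b := hb; linarith
      filter_upwards [hV y (-b) hb'] with y' hy'
      linarith
    have hHn : Continuous fun q : Space N × Space N => (fun x p => -H x (-p)) q.1 q.2 :=
      (hH.comp (continuous_fst.prodMk continuous_snd.neg)).neg
    have := eventually_jumpExpr_ge (H := fun x p => -H x (-p)) lam hν hM2 hM3 hM4 hHn hfst ha
      (u := fun _ y => -V y) (K := K) (fun _ => hVn.measurable)
      (fun _ y => by rw [abs_neg]; exact hVK y) hVn (fun y => by rw [abs_neg]; exact hVK y)
      (fun _ _ => le_rfl) htest.neg hs0 (by linarith) (by linarith)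
      (show 0 < -jumpExpr lam ν H V φη (V x) x s by linarith)
    filter_upwards [this] with q hq
    rw [jumpExpr_neg, jumpExpr_neg] at hq
    linarith
  obtain ⟨ρ, hρ, hneg⟩ := Metric.eventually_nhds_iff.1 hneg
  set σ := min s ρ with hσ
  have hσ0 : 0 < σ := by positivity
  -- The bound `η σ²` forces the raised test function `B` below `V ≤ U` at distance `σ` or more from
  -- `x`, by strictness of the minimum; the bound `ρ/2` keeps `(y, κ)` where the expression is known
  -- to be nonpositive.
  set κ := min (ρ / 2) (η * σ ^ 2) with hκ
  have hκ0 : 0 < κ := by positivity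
  have hκρ : κ < ρ := by have := min_le_left (ρ / 2) (η * σ ^ 2); linarith
  set B : Space N → ℝ := fun y => φη y + c + κ with hB
  have hnear : ∀ y ∈ ball x t, U y < B y → ‖y - x‖ < σ := by
    intro y hy hlt
    have h1 := hmin y (ball_subset_ball htδ hy)
    have h2 := hVU y
    simp only [hB, hφη] at hlt
    have h3 : η * ‖y - x‖ ^ 2 < η * σ ^ 2 := by
      have := min_le_right (ρ / 2) (η * σ ^ 2)
      linarith
    exact lt_of_pow_lt_pow_left₀ 2 hσ0.le (lt_of_mul_lt_mul_left h3 hη.le)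
  classical
  set W : Space N → ℝ := fun y => if y ∈ ball x t then max (U y) (B y) else U y with hW
  have hUW : ∀ y, U y ≤ W y := fun y => by
    simp only [hW]
    split_ifs
    · exact le_max_left _ _
    · exact le_rfl
  have hBW : ∀ y ∈ ball x t, B y ≤ W y := fun y hy => by
    simp only [hW, if_pos hy]
    exact le_max_right _ _
  have hWfar : ∀ y, σ ≤ ‖y - x‖ → W y = U y := fun y hy => by
    simp only [hW]
    split_ifs with h
    · refine max_eq_left (not_lt.1 fun h' => ?_)
      exact absurd (hnear y h h') (not_lt.2 hy)
    · rfl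
  have hWusc : UpperSemicontinuous W := by
    intro y b hb
    by_cases hy : y ∈ ball x t
    · have hb' : max (U y) (B y) < b := by
        have : W y < b := hb
        simpa only [hW, if_pos hy] using this
      have hBc : ContinuousAt B y := ((hcd.continuousOn.continuousAt
        (isOpen_ball.mem_nhds (ball_subset_ball htδ hy))).add_const c).add_const κ
      filter_upwards [hU.1 y b ((le_max_left _ _).trans_lt hb'),
        hBc.eventually (gt_mem_nhds ((le_max_right _ _).trans_lt hb')),
        isOpen_ball.mem_nhds hy] with y' h1 h2 h3
      show W y' < b
      simp only [hW, if_pos h3]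
      exact max_lt h1 h2
    · have hyt : t ≤ ‖y - x‖ := by rwa [mem_ball_iff_norm, not_lt] at hy
      have hσt : σ < ‖y - x‖ := by have := min_le_left s ρ; linarith
      have hb' : U y < b := by
        rw [← hWfar y hσt.le]; exact hb
      have hcn : ContinuousAt (fun y => ‖y - x‖) y := by fun_prop
      filter_upwards [hU.1 y b hb', hcn.eventually (lt_mem_nhds hσt)] with y' h1 h2
      show W y' < b
      rw [hWfar y' h2.le]
      exact h1
  have hWbdd : IsBddFun W := by
    obtain ⟨K₁, hK₁⟩ := hU.2.1
    refine ⟨max K₁ (Kφ + |(-η)| + |c| + κ), fun y => ?_⟩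
    by_cases hy : y ∈ ball x t
    · have h1 := abs_le.1 (hK₁ y)
      have h2 := hbd y (ball_subset_ball htδ hy)
      have h3 : |B y| ≤ Kφ + |(-η)| + |c| + κ := by
        have h4 := abs_add_le (φη y + c) κ
        have h5 := abs_add_le (φη y) c
        rw [abs_of_pos hκ0] at h4
        have h6 : |φη y| ≤ Kφ + |(-η)| := h2
        simp only [hB]
        linarith
      simp only [hW, if_pos hy]
      exact abs_max_le_max_abs_abs.trans (max_le_max (hK₁ y) h3)
    · simp only [hW, if_neg hy]
      exact (hK₁ y).trans (le_max_left _ _)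
  have hWsub : IsViscositySubsolution lam ν H W := by
    refine ⟨hWusc, hWbdd, fun ψ y δ' hδ' hψ hψK hψmax => ?_⟩
    have hψK' : ∃ K, ∀ y' ∈ ball y δ', |ψ y'| ≤ K := hψK.imp fun _ h y' _ => h y'
    rw [viscExpr_eq_jumpExpr lam hν H hδ' hWusc.measurable hWbdd hψ hψK']
    obtain ⟨C₁, hC₁⟩ := exists_levyBounded_jump (W y) hδ' hWusc.measurable hWbdd hψ hψK'
    -- Where `W` touches `U`, a test function above `W` also tests `U`, and the larger jumps of `W`
    -- only help. Elsewhere `W = B` and the strict negativity near `x` takes over.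
    by_cases hWU : W y = U y
    · have h1 := hU.jumpExpr_le hν hδ' hψ hψK' (fun y' hy' => by
        have := hψmax y' hy'
        have := hUW y'
        linarith)
      obtain ⟨C₂, hC₂⟩ := exists_levyBounded_jump (U y) hδ' hU.1.measurable hU.2.1 hψ hψK'
      rw [hWU] at hC₁ ⊢
      refine (jumpExpr_mono rfl (hC₂.integrable (hν y)) (hC₁.integrable (hν y)) fun z => ?_).trans h1
      split_ifs
      · exact le_rfl
      · linarith [hUW (y + z)]
    · have hyt : y ∈ ball x t := by
        by_contra h
        exact hWU (by simp only [hW, if_neg h])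
      have hUB : U y < B y := by
        by_contra h
        exact hWU (by simp only [hW, if_pos hyt]; exact max_eq_left (not_lt.1 h))
      have hWB : W y = B y := by
        simp only [hW, if_pos hyt]; exact max_eq_right hUB.le
      have hyσ := hnear y hyt hUB
      have hys : ‖y - x‖ < s := hyσ.trans_le (min_le_left _ _)
      have hyρ : ‖y - x‖ < ρ := hyσ.trans_le (min_le_right _ _)
      have hsub : ball y s ⊆ ball x t := fun y' hy' => by
        rw [mem_ball] at *
        rw [← dist_eq_norm] at hys
        linarith [dist_triangle y' y x]
      have hgrad : gradient φη y = gradient ψ y := by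
        refine gradient_eq_of_isLocalMax_sub
          ((htest.contDiffOn.contDiffAt (isOpen_ball.mem_nhds hyt)).differentiableAt (by simp))
          ((hψ.contDiffAt (ball_mem_nhds y hδ')).differentiableAt (by simp)) ?_
        filter_upwards [isOpen_ball.mem_nhds hyt, ball_mem_nhds y hδ'] with y' h1 h2
        have h3 := hψmax y' h2
        have h4 := hBW y' h1
        rw [hWB] at h3
        simp only [hB] at h3 h4
        linarith
      obtain ⟨C₂, hC₂⟩ := exists_levyBounded_jump (W y) (x := y) hs0 hV.measurable ⟨K, hVK⟩
        (htest.contDiffOn.mono hsub) ⟨_, fun y' hy' => htest.bound y' (hsub hy')⟩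
      have hle := hneg (y := (y, κ)) (by
        rw [Prod.dist_eq, max_lt_iff, dist_eq_norm, Real.dist_eq, sub_zero, abs_of_pos hκ0]
        exact ⟨hyρ, hκρ⟩)
      have hWB' : φη y + c + κ = W y := hWB.symm
      simp only [hWB'] at hle
      refine (jumpExpr_mono hgrad (hC₂.integrable (hν y)) (hC₁.integrable (hν y))
        fun z => ?_).trans hle
      -- The chain behind the inequality at `y`: increments of the pair `(V, φη)` based at height `W
      -- y` are below those of `W`, which are below those of `(W, ψ)`. This is where the free height
      -- in `jumpExpr` is used, since `W y` is not the value of `V`.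
      have h1 : (if ‖z‖ < s then φη (y + z) - φη y else V (y + z) - W y) ≤ W (y + z) - W y := by
        split_ifs with hz
        · have h2 := hBW (y + z) (hsub (by simpa using hz))
          rw [hWB]
          simp only [hB] at h2 ⊢
          linarith
        · linarith [hVU (y + z), hUW (y + z)]
      refine h1.trans ?_
      split_ifs with hz
      · have := hψmax (y + z) (by simpa using hz)
        linarith
      · exact le_rfl
  -- Near `x` the bump exceeds `V x + κ/2`, while `U` takes values below `V x + κ/2` arbitrarily
  -- close to `x`; so `W ≤ U` fails.
  have hWU := hmaxl W hWsub hUW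
  have hBx : ∀ᶠ y in 𝓝 x, V x + κ / 2 < B y := by
    have h1 : ContinuousAt B x := (hcont.add_const c).add_const κ
    refine h1.eventually (lt_mem_nhds ?_)
    simp only [hB, hφηx, hc]
    linarith
  obtain ⟨τ, hτ, hBx⟩ := Metric.eventually_nhds_iff.1 hBx
  obtain ⟨y, hy1, hy2⟩ := happ x (min (min τ t) (κ / 2)) (by positivity)
  have h1 : ‖y - x‖ < τ := hy1.trans_le ((min_le_left _ _).trans (min_le_left _ _))
  have h2 : ‖y - x‖ < t := hy1.trans_le ((min_le_left _ _).trans (min_le_right _ _))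
  have h3 := min_le_right (min τ t) (κ / 2)
  have h4 := hBx (y := y) (by rwa [dist_eq_norm])
  have h5 := hBW y (by rwa [mem_ball_iff_norm])
  have h6 := hWU y
  linarith

/-! ### Existence -/

/-- Perron's method: the largest subsolution is a continuous solution. -/
theorem exists_isViscositySolution {lam : ℝ} (hlam : 0 < lam) {ν : Space N → Measure (Space N)}
    (hν : ∀ ξ, IsLevyMeasure (ν ξ)) (hM1 : AssumptionM1 ν) (hM2 : AssumptionM2 ν)
    (hM3 : AssumptionM3 ν) (hM4 : AssumptionM4 ν) {H : Space N → Space N → ℝ} {m : ℝ} (hm : 1 < m)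
    (hH0 : AssumptionH0 H) (hH1 : AssumptionH1 H m) (hH2 : AssumptionH2 H m) :
    ∃ u, IsViscositySolution lam ν H u := by
  obtain ⟨C, hC⟩ := hH0.2
  -- With `λK = C ≥ |H(·,0)|`, the constants `-K` and `K` are a sub- and a supersolution.
  set K := C / lam with hK
  have hlK : lam * K = C := by rw [hK]; field_simp
  have hsub : IsViscositySubsolution lam ν H (fun _ => -K) :=
    isViscositySubsolution_const hν fun x => by
      have := (abs_le.1 (hC x)).2
      rw [mul_neg, hlK]; linarith
  have hsup : IsViscositySupersolution lam ν H (fun _ => K) :=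
    isViscositySupersolution_const hν fun x => by
      have := (abs_le.1 (hC x)).1
      rw [hlK]; linarith
  -- The lower bound `-K` is imposed; the upper bound `K` follows by comparison with the constant
  -- supersolution.
  set S : Set (Space N → ℝ) := {w | IsViscositySubsolution lam ν H w ∧ ∀ x, -K ≤ w x} with hS
  have hKS : (fun _ => -K) ∈ S := ⟨hsub, fun _ => le_rfl⟩
  have hSK : ∀ w ∈ S, ∀ x, |w x| ≤ K := fun w hw x =>
    abs_le.2 ⟨hw.2 x, comparison hlam hν hM1 hM2 hM3 hM4 hm hH0 hH1 hH2 hw.1 hsup x⟩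
  set U : Space N → ℝ := fun x => sSup ((fun w : Space N → ℝ => w x) '' S) with hU
  have hbdd : ∀ x, BddAbove ((fun w : Space N → ℝ => w x) '' S) := fun x => by
    refine ⟨K, ?_⟩
    rintro _ ⟨w, hw, rfl⟩
    exact (abs_le.1 (hSK w hw x)).2
  have hne : ∀ x, ((fun w : Space N → ℝ => w x) '' S).Nonempty := fun x => ⟨_, _, hKS, rfl⟩
  have hleU : ∀ w ∈ S, ∀ x, w x ≤ U x := fun w hw x => le_csSup (hbdd x) ⟨w, hw, rfl⟩
  have hUK : ∀ x, |U x| ≤ K := fun x => by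
    refine abs_le.2 ⟨hleU _ hKS x, csSup_le (hne x) ?_⟩
    rintro _ ⟨w, hw, rfl⟩
    exact (abs_le.1 (hSK w hw x)).2
  obtain ⟨V, hV, hUV, hVK, hVapp⟩ := exists_upper_envelope hUK
  have hVsub : IsViscositySubsolution lam ν H V := by
    refine isViscositySubsolution_of_approx hν hM2 hM3 hM4 hH0.1 (fun w hw => hw.1) hSK hV hVK
      (fun w hw x => (hleU w hw x).trans (hUV x)) fun x η hη => ?_
    obtain ⟨y, h1, h2⟩ := hVapp x η hη
    obtain ⟨_, ⟨w, hw, rfl⟩, h3⟩ := exists_lt_of_lt_csSup (hne y) h2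
    exact ⟨y, h1, w, hw, h3⟩
  -- The envelope is a subsolution above `-K`, so it competes in the supremum defining `U` and
  -- cannot exceed it.
  have hVU : ∀ x, V x = U x := fun x =>
    le_antisymm (hleU V ⟨hVsub, fun x => (abs_le.1 (hVK x)).1⟩ x) (hUV x)
  have hUsub : IsViscositySubsolution lam ν H U := by rwa [← funext hVU]
  obtain ⟨Z, hZ, hZU, hZK, hZapp⟩ := exists_lower_envelope hUK
  have hZsup : IsViscositySupersolution lam ν H Z :=
    isViscositySupersolution_of_maximal hν hM2 hM3 hM4 hH0.1 hUsub
      (fun w hw hUw => hleU w ⟨hw, fun x => ((abs_le.1 (hUK x)).1).trans (hUw x)⟩)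
      hZ hZK hZU hZapp
  have hUZ : ∀ x, U x = Z x := fun x =>
    le_antisymm (comparison hlam hν hM1 hM2 hM3 hM4 hm hH0 hH1 hH2 hUsub hZsup x) (hZU x)
  have hUsup : IsViscositySupersolution lam ν H U := by rwa [funext hUZ]
  exact ⟨U, continuous_iff_lower_upperSemicontinuous.2 ⟨hUsup.1, hUsub.1⟩, ⟨K, hUK⟩, hUsub, hUsup⟩

end NonlocalHJ

theorem theorem2p2 {N : ℕ} (lam : ℝ) (hlam : 0 < lam)
    (ν : NonlocalHJ.Space N → Measure (NonlocalHJ.Space N))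
    (hν : ∀ ξ, NonlocalHJ.IsLevyMeasure (ν ξ))
    (hM1 : NonlocalHJ.AssumptionM1 ν) (hM2 : NonlocalHJ.AssumptionM2 ν)
    (hM3 : NonlocalHJ.AssumptionM3 ν) (hM4 : NonlocalHJ.AssumptionM4 ν)
    (H : NonlocalHJ.Space N → NonlocalHJ.Space N → ℝ) (m : ℝ) (hm : 1 < m)
    (hH0 : NonlocalHJ.AssumptionH0 H) (hH1 : NonlocalHJ.AssumptionH1 H m)
    (hH2 : NonlocalHJ.AssumptionH2 H m) :
    ∃! u : NonlocalHJ.Space N → ℝ, NonlocalHJ.IsViscositySolution lam ν H u := by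
  obtain ⟨u, hu⟩ := NonlocalHJ.exists_isViscositySolution hlam hν hM1 hM2 hM3 hM4 hm hH0 hH1 hH2
  refine ⟨u, hu, fun v hv => funext fun x => le_antisymm ?_ ?_⟩
  · exact NonlocalHJ.comparison hlam hν hM1 hM2 hM3 hM4 hm hH0 hH1 hH2 hv.2.2.1 hu.2.2.2 x
  · exact NonlocalHJ.comparison hlam hν hM1 hM2 hM3 hM4 hm hH0 hH1 hH2 hu.2.2.1 hv.2.2.2 x
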